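/- All graphs are finite and simple (the empty graph is allowed), and classes of graphs are considered up to isomorphism. For a graph $G$ and disjoint $A,B\subseteq V(G)$, let $G[A,B]$ be the bipartite graph with bipartition $\{A,B\}$ in which $a\in A$ and $b\in B$ are adjacent if and only if they are adjacent in $G$. A bipartite graph $H$ with a fixed bipartition is a *semi-induced subgraph* of $G$ if $H$ is isomorphic, by an isomorphism that respects the bipartitions, to $G[A,B]$ for some disjoint $A,B\subseteq V(G)$. Let $P_t$ be the path on $t$ vertices, let $\widetilde{P}_t$ be its bipartite complement (same vertices, same bipartition as $P_t$; two vertices from different sides are adjacent if and only if they are not adjacent in $P_t$), and let $H_k$ be the half-graph of order $k$, with sides $\{a_1,\dots,a_k\}$ and $\{b_1,\dots,b_k\}$ and edges $a_ib_j$ for $1\le i\le j\le k$. A *(first-order, non-copying) transduction* $\mathsf T$ is given by two first-order formulas $\rho_0(x)$ and $\rho_E(x,y)$ in the signature consisting of the binary edge relation $E$ and unary predicates $P_i$, $i\in\mathbb N$. For a graph $G$, $\mathsf T(G)$ is the set of all graphs obtained by interpreting the predicates $P_i$ in $G$ as arbitrary vertex subsets, and then taking the graph whose vertices are the vertices satisfying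 $\rho_0$ and whose edge relation is defined on them by $\rho_E$. A class $\mathscr D$ *can be transduced* from a class $\mathscr C$ if there is a transduction $\mathsf T$ with $\mathscr D\subseteq\bigcup_{G\in\mathscr C}\mathsf T(G)$; two classes are *transduction-equivalent* if each can be transduced from the other. A graph is *$d$-degenerate* if each of its nonempty subgraphs has a vertex of degree at most $d$ in that subgraph. **Theorem.** Let $s,t,k\in\mathbb N$ and let $\mathscr C$ be a class of graphs such that no graph in $\mathscr C$ contains $P_s$, $\widetilde{P}_t$, or $H_k$ as a semi-induced subgraph. Then there exist $d\in\mathbb N$ and a class $\mathscr D$ of $d$-degenerate graphs such that $\mathscr C$ and $\mathscr D$ are transduction-equivalent. -/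

import Mathlib

universe u v

namespace Sparsify

/-! ### Finite graphs and degeneracy -/

/-- A finite simple graph (the empty graph is allowed). A class of graphs is a `Set FinGraph`. -/
structure FinGraph : Type (u + 1) where
  V : Type u
  finite : Finite V
  graph : SimpleGraph V

/-- A finite graph is `d`-degenerate if every nonempty subgraph of it has a vertex
whose degree in that subgraph is at most `d`. -/
def FinGraph.IsDegenerate (d : ℕ) (G : FinGraph.{u}) : Prop :=
  ∀ H : G.graph.Subgraph, H.verts.Nonempty → ∃ x ∈ H.verts, (H.neighborSet x).ncard ≤ d

/-- A class of degenerate graphs: for some `d`, all its members are `d`-degenerate. -/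
def IsDegenerateClass (D : Set FinGraph.{u}) : Prop :=
  ∃ d : ℕ, ∀ G ∈ D, G.IsDegenerate d

/-! ### Bipartite graphs with a fixed bipartition, and semi-induced subgraphs -/

/-- A bipartite graph given together with a bipartition; the sides are `left` and `leftᶜ`. -/
structure BipGraph (α : Type v) where
  graph : SimpleGraph α
  left : Set α
  isBipartiteWith : graph.IsBipartiteWith left leftᶜ

/-- The bipartite complement: same vertices, same bipartition, and two vertices from different
sides are adjacent if and only if they were not adjacent before. -/
def BipGraph.bipCompl {α : Type v} (H : BipGraph α) : BipGraph α where
  graph := H.graphᶜ.between H.left H.leftᶜ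
  left := H.left
  isBipartiteWith := ⟨disjoint_compl_right, fun _ _ h => h.2⟩

/-- The path `P_t` on `t` vertices `0, 1, …, t - 1`, with its bipartition into even and odd
vertices. -/
def bipPath (t : ℕ) : BipGraph (Fin t) where
  graph := SimpleGraph.pathGraph t
  left := {i | Even i.val}
  isBipartiteWith := by
    refine ⟨disjoint_compl_right, fun i j h => ?_⟩
    rw [SimpleGraph.pathGraph_adj] at h
    simp only [Set.mem_compl_iff, Set.mem_ofPred_eq]
    grind

/-- The half-graph `H_k` of order `k`: its sides are `a_1, …, a_k` and `b_1, …, b_k`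
(here `a_i = Sum.inl i` and `b_j = Sum.inr j`), and its edges are `a_i b_j` for `i ≤ j`. -/
def halfGraph (k : ℕ) : BipGraph (Fin k ⊕ Fin k) where
  graph := SimpleGraph.fromRel fun x y => ∃ i j : Fin k, x = Sum.inl i ∧ y = Sum.inr j ∧ i ≤ j
  left := Set.range Sum.inl
  isBipartiteWith := by
    refine ⟨disjoint_compl_right, fun x y h => ?_⟩
    rw [SimpleGraph.fromRel_adj] at h
    obtain ⟨-, ⟨i, j, rfl, rfl, -⟩ | ⟨i, j, rfl, rfl, -⟩⟩ := h <;> simp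

/-- `H` is a semi-induced subgraph of `G`: there are disjoint vertex sets `A`, `B` of `G` such that
`G[A, B]`, the graph on `A ∪ B` with the edges of `G` between `A` and `B`, bipartitioned into `A`
and `B`, is isomorphic to `H` as a bipartite graph. -/
def BipGraph.IsSemiInducedIn {α : Type v} (H : BipGraph α) {V : Type u} (G : SimpleGraph V) :
    Prop :=
  ∃ A B : Set V, Disjoint A B ∧
    ∃ e : H.graph ≃g (G.between A B).induce (A ∪ B), ∀ x, x ∈ H.left ↔ (e x : V) ∈ A

/-! ### First-order transductions -/

/-- Relation symbols of the signature of colored graphs: the binary edge relation and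
unary predicates `P_i`, `i ∈ ℕ`. -/
inductive ColoredRel : ℕ → Type
  | edge : ColoredRel 2
  | color (i : ℕ) : ColoredRel 1

/-- The signature of colored graphs. -/
def coloredGraphs : FirstOrder.Language.{0, 0} := ⟨fun _ => Empty, ColoredRel⟩

/-- The structure obtained from the graph `G` by interpreting each `P_i` as the set `c i`. -/
@[reducible] def coloring {V : Type u} (G : SimpleGraph V) (c : ℕ → Set V) :
    coloredGraphs.Structure V where
  funMap f := nomatch f
  RelMap
    | .edge => fun x => G.Adj (x 0) (x 1)
    | .color i => fun x => x 0 ∈ c i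

/-- A (non-copying, first-order) transduction of graphs: a simple interpretation of graphs in
colored graphs, that is, a formula `dom(x)` and a formula `edge(x, y)`. -/
structure Transduction where
  dom : coloredGraphs.Formula (Fin 1)
  edge : coloredGraphs.Formula (Fin 2)

/-- The domain defined by `dom` in the coloring of `G` by `c`. -/
def Transduction.domain (T : Transduction) {V : Type u} (G : SimpleGraph V) (c : ℕ → Set V) :
    Set V :=
  letI := coloring G c
  {x | T.dom.Realize ![x]}

/-- The binary relation defined by `edge` in the coloring of `G` by `c`. -/
def Transduction.edgeRel (T : Transduction) {V : Type u} (G : SimpleGraph V) (c : ℕ → Set V) :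
    V → V → Prop :=
  letI := coloring G c
  fun x y => T.edge.Realize ![x, y]

/-- `T(G)`, as a class of graphs up to isomorphism: all graphs `H` isomorphic to the result of
the interpretation on some coloring of `G`. (If that result is not symmetric and irreflexive then
it is not a graph and contributes nothing.) -/
def Transduction.image (T : Transduction) (G : FinGraph.{u}) : Set FinGraph.{u} :=
  {H | ∃ c : ℕ → Set G.V, ∃ e : H.V ≃ T.domain G.graph c,
    ∀ x y : H.V, H.graph.Adj x y ↔ T.edgeRel G.graph c (e x) (e y)}

/-- The class `D` can be transduced from the class `C`: `D ⊆ T(C)` for some transduction `T`. -/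
def CanBeTransduced (D C : Set FinGraph.{u}) : Prop :=
  ∃ T : Transduction, D ⊆ ⋃ G ∈ C, T.image G

/-- Transduction equivalence of two classes of graphs. -/
def TransductionEquivalent (C D : Set FinGraph.{u}) : Prop :=
  CanBeTransduced D C ∧ CanBeTransduced C D

end Sparsify

namespace Sparsify

open FirstOrder FirstOrder.Language

/-! ### Relation-algebra expressions over colored graphs -/

/-! Equivalence relations mediate between the two classes. The adjacency of the given graphs can be
recovered from finitely many equivalence relations definable in them (`isEncoded_adj`), and finitely
many equivalence relations can be stored in a degenerate graph that joins every vertex to a chosen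
representative of each of its classes (`IsEncoded.exists_degenerate`).

For the first half, excluding a half-graph bounds the height of trees that split vertices by
neighborhoods (`exists_not_hasRank`). Adjacency between `X` and `Y`, inside the classes of a
definable equivalence relation, is treated by induction on the sum of the rank bounds of `X` against
`Y` and of `Y` against `X` (`isReducible`). By the definition of rank, each vertex of one side has a
neighborhood or a non-neighborhood of smaller rank on the other side, so each side splits into two
parts. If neighborhoods are small on both sides, the edges form a graph without long induced paths.
The Gyárfás path argument (`exists_level`) then gives boundedly many levels such that each component
of the graph on the levels from `j` up meets level `j` inside one neighborhood, hence in smaller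
rank. Being in the same component is definable because distances are bounded
(`IsDefinable.reachable`), and every edge lies in a component belonging to its lower level. If
non-neighborhoods are small on both sides, the same argument applies to the non-edges, with the
co-path excluded. In the mixed case, the absence of a half-graph covers one of the sides by at most
`k + 1` sets of smaller rank (`exists_cover_of_not_halfGraph`).

For the second half, Hall's theorem gives large classes of different relations different
representatives, and a coloring with boundedly many colors lets every vertex recognize its
representatives among its neighbors (`exists_representatives_coloring`). -/

/-- Expressions for binary relations on the vertices of a colored graph. -/
inductive RelExpr : Type
  | adj
  | eq
  | color (i : ℕ)
  | not (e : RelExpr)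
  | and (e f : RelExpr)
  | comp (e f : RelExpr)
  | conv (e : RelExpr)

namespace RelExpr

variable {V : Type u}

/-- The binary relation denoted by an expression. -/
def eval (G : SimpleGraph V) (c : ℕ → Set V) : RelExpr → V → V → Prop
  | adj => fun x y => G.Adj x y
  | eq => fun x y => x = y
  | color i => fun x _ => x ∈ c i
  | not e => fun x y => ¬ e.eval G c x y
  | and e f => fun x y => e.eval G c x y ∧ f.eval G c x y
  | comp e f => fun x y => ∃ z, e.eval G c x z ∧ f.eval G c z y
  | conv e => fun x y => e.eval G c y x

/-- Renaming of the colors of an expression. -/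
def map (g : ℕ → ℕ) : RelExpr → RelExpr
  | adj => adj
  | eq => eq
  | color i => color (g i)
  | not e => not (e.map g)
  | and e f => and (e.map g) (f.map g)
  | comp e f => comp (e.map g) (f.map g)
  | conv e => conv (e.map g)

theorem eval_map (G : SimpleGraph V) (c : ℕ → Set V) (g : ℕ → ℕ) (e : RelExpr) (x y : V) :
    (e.map g).eval G c x y ↔ e.eval G (c ∘ g) x y := by
  induction e generalizing x y with
  | adj => rfl
  | eq => rfl
  | color i => rfl
  | not e ih => simp only [map, eval, ih]
  | and e f ihe ihf => simp only [map, eval, ihe, ihf]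
  | comp e f ihe ihf => simp only [map, eval, ihe, ihf]
  | conv e ih => simp only [map, eval, ih]

/-- The first-order formula expressing a relation-algebra expression. -/
def toFormula : RelExpr → coloredGraphs.Formula (Fin 2)
  | adj => Relations.formula₂ (L := coloredGraphs) ColoredRel.edge (Term.var 0) (Term.var 1)
  | eq => Term.equal (Term.var 0) (Term.var 1)
  | color i => Relations.formula₁ (L := coloredGraphs) (ColoredRel.color i) (Term.var 0)
  | not e => Formula.not e.toFormula
  | and e f => e.toFormula ⊓ f.toFormula
  | comp e f =>
      BoundedFormula.ex (n := 0)
        ((BoundedFormula.relabel (n := 1) (k := 0)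
            (![Sum.inl 0, Sum.inr 0] : Fin 2 → Fin 2 ⊕ Fin 1) e.toFormula) ⊓
          (BoundedFormula.relabel (n := 1) (k := 0)
            (![Sum.inr 0, Sum.inl 1] : Fin 2 → Fin 2 ⊕ Fin 1) f.toFormula))
  | conv e => Formula.relabel (![1, 0] : Fin 2 → Fin 2) e.toFormula

theorem realize_toFormula (G : SimpleGraph V) (c : ℕ → Set V) (e : RelExpr) (x y : V) :
    letI := coloring G c
    e.toFormula.Realize ![x, y] ↔ e.eval G c x y := by
  let := coloring G c
  induction e generalizing x y with
  | adj =>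
    simp only [toFormula, eval]
    rfl
  | eq => simp [toFormula, eval, Formula.realize_equal]
  | color i =>
    simp only [toFormula, eval]
    rfl
  | not e ih => simp only [toFormula, eval, Formula.realize_not, ih]
  | and e f ihe ihf => simp only [toFormula, eval, Formula.realize_inf, ihe, ihf]
  | comp e f ihe ihf =>
    simp only [toFormula, eval, Formula.Realize]
    erw [BoundedFormula.realize_ex]
    refine exists_congr fun z => ?_
    erw [BoundedFormula.realize_inf, BoundedFormula.realize_relabel,
      BoundedFormula.realize_relabel]
    refine and_congr ?_ ?_
    · refine Iff.trans (iff_of_eq ?_) (ihe x z)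
      refine (congrArg₂ _ ?_ (Subsingleton.elim _ _))
      funext i
      fin_cases i <;> rfl
    · refine Iff.trans (iff_of_eq ?_) (ihf z y)
      refine (congrArg₂ _ ?_ (Subsingleton.elim _ _))
      funext i
      fin_cases i <;> rfl
  | conv e ih =>
    simp only [toFormula, eval, Formula.realize_relabel]
    refine Iff.trans (iff_of_eq (congrArg _ ?_)) (ih y x)
    funext i
    fin_cases i <;> rfl

end RelExpr

/-! ### Uniform definability in families of colored graphs -/

variable {ι : Type v} {V : ι → Type u}

/-- A family of binary relations is definable in a family of graphs if, after coloring each graph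
suitably, a single expression defines it in all of them. -/
def IsDefinable (G : ∀ i, SimpleGraph (V i)) (R : ∀ i, V i → V i → Prop) : Prop :=
  ∃ e : RelExpr, ∀ i, ∃ c : ℕ → Set (V i), ∀ x y, R i x y ↔ e.eval (G i) c x y

namespace IsDefinable

variable {G : ∀ i, SimpleGraph (V i)} {R S : ∀ i, V i → V i → Prop}

theorem congr (h : IsDefinable G R) (hRS : ∀ i x y, S i x y ↔ R i x y) : IsDefinable G S := by
  obtain ⟨e, he⟩ := h
  refine ⟨e, fun i => ?_⟩
  obtain ⟨c, hc⟩ := he i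
  exact ⟨c, fun x y => (hRS i x y).trans (hc x y)⟩

variable (G) in
theorem adj : IsDefinable G (fun i x y => (G i).Adj x y) :=
  ⟨.adj, fun _ => ⟨fun _ => ∅, fun _ _ => Iff.rfl⟩⟩

variable (G) in
theorem eq : IsDefinable G (fun _ x y => x = y) :=
  ⟨.eq, fun _ => ⟨fun _ => ∅, fun _ _ => Iff.rfl⟩⟩

variable (G) in
theorem memLeft (U : ∀ i, Set (V i)) : IsDefinable G (fun i x _ => x ∈ U i) :=
  ⟨.color 0, fun i => ⟨fun _ => U i, fun _ _ => Iff.rfl⟩⟩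

variable (G) in
theorem memRight (U : ∀ i, Set (V i)) : IsDefinable G (fun i _ y => y ∈ U i) :=
  ⟨.conv (.color 0), fun i => ⟨fun _ => U i, fun _ _ => Iff.rfl⟩⟩

theorem not (h : IsDefinable G R) : IsDefinable G (fun i x y => ¬ R i x y) := by
  obtain ⟨e, he⟩ := h
  refine ⟨.not e, fun i => ?_⟩
  obtain ⟨c, hc⟩ := he i
  exact ⟨c, fun x y => not_congr (hc x y)⟩

theorem conv (h : IsDefinable G R) : IsDefinable G (fun i x y => R i y x) := by
  obtain ⟨e, he⟩ := h
  refine ⟨.conv e, fun i => ?_⟩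
  obtain ⟨c, hc⟩ := he i
  exact ⟨c, fun x y => hc y x⟩

/-- Two definable families can be defined in a common coloring. -/
theorem common (hR : IsDefinable G R) (hS : IsDefinable G S) :
    ∃ e f : RelExpr, ∀ i, ∃ c : ℕ → Set (V i),
      (∀ x y, R i x y ↔ e.eval (G i) c x y) ∧ ∀ x y, S i x y ↔ f.eval (G i) c x y := by
  obtain ⟨e, he⟩ := hR
  obtain ⟨f, hf⟩ := hS
  -- The two colorings are interleaved on even and odd indices.
  refine ⟨e.map (fun n => 2 * n), f.map (fun n => 2 * n + 1), fun i => ?_⟩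
  obtain ⟨c, hc⟩ := he i
  obtain ⟨d, hd⟩ := hf i
  refine ⟨fun n => if n % 2 = 0 then c (n / 2) else d (n / 2), fun x y => ?_, fun x y => ?_⟩
  · rw [RelExpr.eval_map, hc]
    refine iff_of_eq (congrArg (fun c => RelExpr.eval (G i) c e x y) ?_)
    funext n
    simp
  · rw [RelExpr.eval_map, hd]
    refine iff_of_eq (congrArg (fun c => RelExpr.eval (G i) c f x y) ?_)
    funext n
    have h1 : (2 * n + 1) % 2 = 1 := by omega
    have h2 : (2 * n + 1) / 2 = n := by omega
    simp [h1, h2]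

theorem and (hR : IsDefinable G R) (hS : IsDefinable G S) :
    IsDefinable G (fun i x y => R i x y ∧ S i x y) := by
  obtain ⟨e, f, h⟩ := common hR hS
  refine ⟨.and e f, fun i => ?_⟩
  obtain ⟨c, h1, h2⟩ := h i
  exact ⟨c, fun x y => and_congr (h1 x y) (h2 x y)⟩

theorem comp (hR : IsDefinable G R) (hS : IsDefinable G S) :
    IsDefinable G (fun i x y => ∃ z, R i x z ∧ S i z y) := by
  obtain ⟨e, f, h⟩ := common hR hS
  refine ⟨.comp e f, fun i => ?_⟩
  obtain ⟨c, h1, h2⟩ := h i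
  exact ⟨c, fun x y => exists_congr fun z => and_congr (h1 x z) (h2 z y)⟩

theorem or (hR : IsDefinable G R) (hS : IsDefinable G S) :
    IsDefinable G (fun i x y => R i x y ∨ S i x y) :=
  (hR.not.and hS.not).not.congr fun i x y => by tauto

variable (G) in
theorem false : IsDefinable G (fun _ _ _ => False) :=
  (memLeft G fun _ => ∅).congr fun i x y => by simp

theorem exists_lt {R : ℕ → ∀ i, V i → V i → Prop} (n : ℕ) (h : ∀ m < n, IsDefinable G (R m)) :
    IsDefinable G (fun i x y => ∃ m < n, R m i x y) := by
  induction n with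
  | zero => exact (false G).congr fun i x y => by simp
  | succ n ih =>
    refine ((ih fun m hm => h m (by omega)).or (h n (by omega))).congr fun i x y => ?_
    rw [Nat.exists_lt_succ_right]

end IsDefinable

/-! ### Relations encoded by finitely many definable equivalence relations -/

/-- A family of relations is encoded by equivalences if there are finitely many families of
equivalence relations, definable in the graphs `G`, from which it can be recovered. -/
def IsEncoded (G : ∀ i, SimpleGraph (V i)) (R : ∀ i, V i → V i → Prop) : Prop :=
  ∃ l : List (∀ i, Setoid (V i)), (∀ r ∈ l, IsDefinable G fun i x y => r i x y) ∧
    ∀ D : ∀ i, SimpleGraph (V i), (∀ r ∈ l, IsDefinable D fun i x y => r i x y) → IsDefinable D R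

namespace IsEncoded

variable {G : ∀ i, SimpleGraph (V i)} {R S : ∀ i, V i → V i → Prop}

theorem congr (h : IsEncoded G R) (hRS : ∀ i x y, S i x y ↔ R i x y) : IsEncoded G S := by
  obtain ⟨l, h1, h2⟩ := h
  exact ⟨l, h1, fun D hD => (h2 D hD).congr hRS⟩

theorem setoid {r : ∀ i, Setoid (V i)} (h : IsDefinable G fun i x y => r i x y) :
    IsEncoded G fun i x y => r i x y :=
  ⟨[r], by simpa using h, fun D hD => hD r (by simp)⟩

variable (G) in
theorem of_forall (h : ∀ D : ∀ i, SimpleGraph (V i), IsDefinable D R) : IsEncoded G R :=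
  ⟨[], by simp, fun D _ => h D⟩

theorem not (h : IsEncoded G R) : IsEncoded G (fun i x y => ¬ R i x y) := by
  obtain ⟨l, h1, h2⟩ := h
  exact ⟨l, h1, fun D hD => (h2 D hD).not⟩

theorem and (hR : IsEncoded G R) (hS : IsEncoded G S) :
    IsEncoded G (fun i x y => R i x y ∧ S i x y) := by
  obtain ⟨l, h1, h2⟩ := hR
  obtain ⟨l', h1', h2'⟩ := hS
  refine ⟨l ++ l', fun r hr => ?_, fun D hD => (h2 D fun r hr => ?_).and (h2' D fun r hr => ?_)⟩
  · exact (List.mem_append.1 hr).elim (h1 r) (h1' r)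
  · exact hD r (List.mem_append_left _ hr)
  · exact hD r (List.mem_append_right _ hr)

theorem or (hR : IsEncoded G R) (hS : IsEncoded G S) :
    IsEncoded G (fun i x y => R i x y ∨ S i x y) :=
  (hR.not.and hS.not).not.congr fun i x y => by tauto

variable (G) in
theorem memLeft (U : ∀ i, Set (V i)) : IsEncoded G (fun i x _ => x ∈ U i) :=
  of_forall G fun D => IsDefinable.memLeft D U

variable (G) in
theorem memRight (U : ∀ i, Set (V i)) : IsEncoded G (fun i _ y => y ∈ U i) :=
  of_forall G fun D => IsDefinable.memRight D U

variable (G) in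
theorem eq : IsEncoded G (fun _ x y => x = y) :=
  of_forall G fun D => IsDefinable.eq D

variable (G) in
theorem false : IsEncoded G (fun _ _ _ => False) :=
  of_forall G fun D => IsDefinable.false D

theorem exists_lt {R : ℕ → ∀ i, V i → V i → Prop} (n : ℕ) (h : ∀ m < n, IsEncoded G (R m)) :
    IsEncoded G (fun i x y => ∃ m < n, R m i x y) := by
  induction n with
  | zero => exact (false G).congr fun i x y => by simp
  | succ n ih =>
    refine ((ih fun m hm => h m (by omega)).or (h n (by omega))).congr fun i x y => ?_
    rw [Nat.exists_lt_succ_right]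

end IsEncoded

/-! ### Induced paths -/

/-- Only pairs with one vertex on each side are compared, so adjacencies of `G` inside the image of
a side play no role. -/
theorem BipGraph.isSemiInducedIn_of_injective {α : Type v} (H : BipGraph α) {V : Type u}
    (G : SimpleGraph V) (f : α → V) (hf : Function.Injective f)
    (h : ∀ x ∈ H.left, ∀ y ∉ H.left, H.graph.Adj x y ↔ G.Adj (f x) (f y)) :
    H.IsSemiInducedIn G := by
  have hmem : ∀ x, f x ∈ f '' H.left ↔ x ∈ H.left := fun x => hf.mem_set_image
  have hmem' : ∀ x, f x ∈ f '' H.leftᶜ ↔ x ∉ H.left := fun x => hf.mem_set_image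
  refine ⟨f '' H.left, f '' H.leftᶜ, ?_, ?_⟩
  · exact (Set.disjoint_image_iff hf).2 disjoint_compl_right
  · have hr : Set.range f = f '' H.left ∪ f '' H.leftᶜ := by
      rw [← Set.image_union, Set.union_compl_self, Set.image_univ]
    let e : α ≃ ↥(f '' H.left ∪ f '' H.leftᶜ) :=
      (Equiv.ofInjective f hf).trans (Equiv.setCongr hr)
    have he : ∀ x, ((e x : ↥(f '' H.left ∪ f '' H.leftᶜ)) : V) = f x := fun x => rfl
    refine ⟨⟨e, ?_⟩, fun x => ?_⟩
    · intro x y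
      rw [SimpleGraph.comap_adj]
      change (G.between _ _).Adj (f x) (f y) ↔ _
      rw [SimpleGraph.between_adj, hmem, hmem, hmem', hmem']
      constructor
      · rintro ⟨hxy, ⟨hx, hy⟩ | ⟨hy, hx⟩⟩
        · exact (h x hx y hy).2 hxy
        · exact ((h y ‹_› x ‹_›).2 hxy.symm).symm
      · intro hxy
        rcases H.isBipartiteWith.mem_of_adj hxy with ⟨hx, hy⟩ | ⟨hx, hy⟩
        · exact ⟨(h x hx y hy).1 hxy, Or.inl ⟨hx, hy⟩⟩
        · exact ⟨((h y hy x hx).1 hxy.symm).symm, Or.inr ⟨hx, hy⟩⟩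
    · exact (hmem x).symm

/-- The first `n` values of `p` are distinct and induce a path of `H`, in this order. -/
def IsInducedPath {V : Type u} (H : SimpleGraph V) (n : ℕ) (p : ℕ → V) : Prop :=
  ∀ a < n, ∀ b < n, (H.Adj (p a) (p b) ↔ a + 1 = b ∨ b + 1 = a) ∧ (p a = p b → a = b)

section InducedPath

variable {V : Type u} {H G : SimpleGraph V} {n : ℕ} {p : ℕ → V}

theorem IsInducedPath.mono (h : IsInducedPath H n p) {m : ℕ} (hm : m ≤ n) :
    IsInducedPath H m p :=
  fun a ha b hb => h a (by omega) b (by omega)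

theorem isSemiInducedIn_bipPath (h : IsInducedPath H n p)
    (hG : ∀ a < n, ∀ b < n, Even a → ¬ Even b → (H.Adj (p a) (p b) ↔ G.Adj (p a) (p b))) :
    (bipPath n).IsSemiInducedIn G := by
  refine (bipPath n).isSemiInducedIn_of_injective G (fun i => p i.1)
    (fun i j hij => Fin.ext ((h i i.2 j j.2).2 hij)) fun i hi j hj => ?_
  rw [← hG i i.2 j j.2 hi hj, (h i i.2 j j.2).1]
  exact SimpleGraph.pathGraph_adj

theorem isSemiInducedIn_bipCompl_bipPath (h : IsInducedPath H n p)
    (hG : ∀ a < n, ∀ b < n, Even a → ¬ Even b → (H.Adj (p a) (p b) ↔ ¬ G.Adj (p a) (p b))) :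
    (bipPath n).bipCompl.IsSemiInducedIn G := by
  refine (bipPath n).bipCompl.isSemiInducedIn_of_injective G (fun i => p i.1)
    (fun i j hij => Fin.ext ((h i i.2 j j.2).2 hij)) fun i hi j hj => ?_
  have hne : i ≠ j := fun hij => hj (hij ▸ hi)
  change ((bipPath n).graphᶜ.between (bipPath n).left (bipPath n).leftᶜ).Adj i j ↔ _
  rw [SimpleGraph.between_adj, SimpleGraph.compl_adj]
  have h1 : (bipPath n).graph.Adj i j ↔ ¬ G.Adj (p i) (p j) := by
    rw [← hG i i.2 j j.2 hi hj, (h i i.2 j j.2).1]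
    exact SimpleGraph.pathGraph_adj
  constructor
  · rintro ⟨⟨-, h2⟩, -⟩
    by_contra h3
    exact h2 (h1.2 h3)
  · intro h2
    exact ⟨⟨hne, fun h3 => h1.1 h3 h2⟩, Or.inl ⟨hi, hj⟩⟩

/-- A shortest walk is an induced path. -/
theorem isInducedPath_getVert {x y : V} (w : H.Walk x y) (hw : w.length = H.dist x y) :
    IsInducedPath H (w.length + 1) w.getVert := by
  have hd : ∀ a ≤ w.length, H.dist x (w.getVert a) = a := by
    intro a ha
    have h1 : H.dist x (w.getVert a) ≤ a := by
      have := SimpleGraph.dist_le (w.take a)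
      rw [SimpleGraph.Walk.take_length] at this
      omega
    have h2 : H.dist (w.getVert a) y ≤ w.length - a := by
      have := SimpleGraph.dist_le (w.drop a)
      rw [SimpleGraph.Walk.drop_length] at this
      omega
    have h3 : w.length ≤ H.dist x (w.getVert a) + H.dist (w.getVert a) y := by
      obtain ⟨w1, hw1⟩ := (w.take a).reachable.exists_walk_length_eq_dist
      obtain ⟨w2, hw2⟩ := (w.drop a).reachable.exists_walk_length_eq_dist
      rw [hw, ← hw1, ← hw2, ← SimpleGraph.Walk.length_append]
      exact SimpleGraph.dist_le _
    omega
  have hadj : ∀ a ≤ w.length, ∀ b ≤ w.length, H.Adj (w.getVert a) (w.getVert b) → b ≤ a + 1 := by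
    intro a ha b hb hab
    obtain ⟨w1, hw1⟩ := (w.take a).reachable.exists_walk_length_eq_dist
    have := SimpleGraph.dist_le (w1.concat hab)
    rw [hd b hb, SimpleGraph.Walk.length_concat, hw1, hd a ha] at this
    exact this
  intro a ha b hb
  have heq : w.getVert a = w.getVert b → a = b := fun h => by
    rw [← hd a (by omega), ← hd b (by omega), h]
  refine ⟨⟨fun h => ?_, ?_⟩, heq⟩
  · have h1 := hadj a (by omega) b (by omega) h
    have h2 := hadj b (by omega) a (by omega) h.symm
    have h3 : a ≠ b := fun h3 => h.ne (congrArg _ h3)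
    omega
  · rintro (rfl | rfl)
    · exact w.adj_getVert_succ (by omega)
    · exact (w.adj_getVert_succ (by omega)).symm

/-- A shortest walk is induced, so excluding induced paths bounds all finite distances. This is what
makes reachability first-order. -/
theorem exists_walk_length_lt_of_reachable (hH : ∀ p, ¬ IsInducedPath H n p) {x y : V}
    (h : H.Reachable x y) : ∃ w : H.Walk x y, w.length < n := by
  obtain ⟨w, hw⟩ := h.exists_walk_length_eq_dist
  refine ⟨w, ?_⟩
  by_contra hlt
  exact hH _ ((isInducedPath_getVert w hw).mono (by omega))

/-- The subgraph of `H` formed by the edges with both ends of level at least `j`. -/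
def levelGraph (H : SimpleGraph V) (l : V → ℕ) (j : ℕ) : SimpleGraph V where
  Adj x y := H.Adj x y ∧ j ≤ l x ∧ j ≤ l y
  symm := ⟨fun _ _ h => ⟨h.1.symm, h.2.2, h.2.1⟩⟩
  loopless := ⟨fun _ h => h.1.ne rfl⟩

theorem levelGraph_adj {l : V → ℕ} {j : ℕ} {x y : V} :
    (levelGraph H l j).Adj x y ↔ H.Adj x y ∧ j ≤ l x ∧ j ≤ l y :=
  Iff.rfl

theorem levelGraph_congr {l l' : V → ℕ} {j : ℕ} (h : ∀ x, j ≤ l x ↔ j ≤ l' x) :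
    levelGraph H l j = levelGraph H l' j := by
  ext x y
  simp only [levelGraph_adj, h]

theorem le_level_of_reachable {l : V → ℕ} {j : ℕ} {x y : V}
    (h : (levelGraph H l j).Reachable x y) (hx : j ≤ l x) : j ≤ l y := by
  obtain ⟨w⟩ := h
  induction w with
  | nil => exact hx
  | cons h _ ih => exact ih h.2.2

/-- Restricting to an upper part of the levels preserves the absence of induced paths, provided
that there are at least two vertices on them. -/
theorem IsInducedPath.of_levelGraph {l : V → ℕ} {j : ℕ} (hn : 2 ≤ n)
    (h : IsInducedPath (levelGraph H l j) n p) : IsInducedPath H n p := by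
  have hl : ∀ a < n, j ≤ l (p a) := by
    intro a ha
    rcases Nat.eq_zero_or_pos a with rfl | hpos
    · exact (((h 0 ha 1 (by omega)).1.2 (Or.inl rfl))).2.1
    · exact (((h (a - 1) (by omega) a ha).1.2 (Or.inl (by omega)))).2.2
  intro a ha b hb
  refine ⟨?_, (h a ha b hb).2⟩
  rw [← (h a ha b hb).1, levelGraph_adj]
  simp [hl a ha, hl b hb]

theorem exists_adj_of_walk {K : SimpleGraph V} {P : V → Prop} {x y : V} (w : K.Walk x y)
    (hx : P x) (hy : ¬ P y) : ∃ a b, K.Reachable x a ∧ K.Adj a b ∧ P a ∧ ¬ P b := by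
  induction w with
  | nil => exact absurd hx hy
  | @cons u v z h w ih =>
    by_cases hv : P v
    · obtain ⟨a, b, h1, h2⟩ := ih hv hy
      exact ⟨a, b, h.reachable.trans h1, h2⟩
    · exact ⟨u, v, SimpleGraph.Reachable.refl _, h, hx, hv⟩

/-- The path `p` of `j + 1` vertices, all but the last nonadjacent to the set `C`, ends at a
neighbor of `C`. -/
def IsAccessPath (H : SimpleGraph V) (j : ℕ) (C : Set V) (p : ℕ → V) : Prop :=
  IsInducedPath H (j + 1) p ∧ (∃ z ∈ C, H.Adj (p j) z) ∧ ∀ i < j, ∀ z ∈ C, ¬ H.Adj (p i) z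

/-- The new end `u` lies in `C`, to which only `p j` among the path vertices has neighbors. Hence
`u` is adjacent to `p j` alone, and shrinking `C` to a part missed by `p j` restores the invariant.
-/
theorem IsAccessPath.extend {j : ℕ} {C C' : Set V} (h : IsAccessPath H j C p) (hC : C' ⊆ C)
    (hC' : ∀ z ∈ C', ¬ H.Adj (p j) z) {u z : V} (hu : u ∈ C) (hpu : H.Adj (p j) u)
    (hz : z ∈ C') (huz : H.Adj u z) : ∃ q, IsAccessPath H (j + 1) C' q := by
  have hq : ∀ i ≤ j, Function.update p (j + 1) u i = p i := fun i hi =>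
    Function.update_of_ne (by omega) _ _
  have hqu : Function.update p (j + 1) u (j + 1) = u := Function.update_self _ _ _
  have hne : ∀ i ≤ j, p i ≠ u := by
    rintro i hi rfl
    rcases hi.lt_or_eq with hi | rfl
    · exact h.2.2 i hi z (hC hz) huz
    · exact hpu.ne rfl
  refine ⟨Function.update p (j + 1) u, ?_, ⟨z, hz, by rwa [hqu]⟩, ?_⟩
  · have key : ∀ a ≤ j, (H.Adj (p a) u ↔ a = j) := by
      intro a ha
      rcases ha.lt_or_eq with ha | rfl
      · exact iff_of_false (h.2.2 a ha u hu) (by omega)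
      · exact iff_of_true hpu rfl
    intro a ha b hb
    rcases Nat.lt_succ_iff_lt_or_eq.1 ha with ha | rfl <;>
      rcases Nat.lt_succ_iff_lt_or_eq.1 hb with hb | rfl
    · rw [hq a (by omega), hq b (by omega)]
      exact h.1 a ha b hb
    · rw [hq a (by omega), hqu, key a (by omega)]
      exact ⟨by omega, fun h => absurd h (hne a (by omega))⟩
    · rw [hq b (by omega), hqu, H.adj_comm, key b (by omega)]
      exact ⟨by omega, fun h => absurd h.symm (hne b (by omega))⟩
    · simp
  · intro i hi z hz
    rw [hq i (by omega)]
    rcases Nat.lt_succ_iff_lt_or_eq.1 hi with hi | rfl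
    · exact h.2.2 i hi z (hC hz)
    · exact hC' z hz

/-- The induction keeps an induced path leading to every component with an edge on the current top
level. Neighbors of the end of that path stay on the level, the rest of the component moves up, and
the path is prolonged into each remaining component that has an edge. -/
theorem exists_level_accessPath (H : SimpleGraph V) (j : ℕ) : ∃ l : V → ℕ, (∀ x, l x ≤ j) ∧
    (∀ i < j, ∀ a, ∃ v, ∀ u, l u = i → (levelGraph H l i).Reachable u a → H.Adj v u) ∧
    ∀ x y, (levelGraph H l j).Adj x y →
      ∃ p, IsAccessPath H j {z | (levelGraph H l j).Reachable x z} p := by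
  classical
  induction j with
  | zero =>
    refine ⟨fun _ => 0, by simp, by simp, fun x y hxy => ⟨fun _ => x, ?_, ⟨y, ?_, hxy.1⟩, by simp⟩⟩
    · intro a ha b hb
      have : a = 0 := by omega
      have : b = 0 := by omega
      subst a b
      simp
    · exact hxy.reachable
  | succ j ih =>
    obtain ⟨l, hl, hcov, hacc⟩ := ih
    -- The access path must depend on the component only, so that a single vertex dominates what
    -- stays on level `j`.
    have hP : ∀ c : (levelGraph H l j).ConnectedComponent, ∃ p : ℕ → V,
        ∀ x y, (levelGraph H l j).connectedComponentMk x = c → (levelGraph H l j).Adj x y →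
          IsAccessPath H j {z | (levelGraph H l j).Reachable x z} p := by
      intro c
      by_cases hc : ∃ x y, (levelGraph H l j).connectedComponentMk x = c ∧
          (levelGraph H l j).Adj x y
      · obtain ⟨x, y, hx, hxy⟩ := hc
        obtain ⟨p, hp⟩ := hacc x y hxy
        refine ⟨p, fun x' y' hx' _ => ?_⟩
        have hr : (levelGraph H l j).Reachable x x' :=
          SimpleGraph.ConnectedComponent.exact (hx.trans hx'.symm)
        convert hp using 3 with z
        exact ⟨fun h => hr.trans h, fun h => hr.symm.trans h⟩
      · obtain ⟨x, -⟩ := c.exists_rep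
        exact ⟨fun _ => x, fun x y hx hxy => absurd ⟨x, y, hx, hxy⟩ hc⟩
    choose P hP using hP
    -- The vertices promoted to level `j + 1`: those of level `j` missed by the end of the path of
    -- their component.
    let T : Set V := {u | l u = j ∧ ¬ H.Adj (P ((levelGraph H l j).connectedComponentMk u) j) u}
    let l' : V → ℕ := fun u => if u ∈ T then j + 1 else l u
    have hT : ∀ u, l' u = j + 1 ↔ u ∈ T := by
      intro u
      by_cases hu : u ∈ T
      · simp [l', hu]
      · have := hl u
        simp only [l', hu, if_false, iff_false]
        omega
    have hlt : ∀ i ≤ j, ∀ u, i ≤ l u ↔ i ≤ l' u := by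
      intro i hi u
      by_cases hu : u ∈ T
      · have := hu.1
        simp only [l', hu, if_true]
        omega
      · simp [l', hu]
    have hgr : ∀ i ≤ j, levelGraph H l i = levelGraph H l' i := fun i hi =>
      levelGraph_congr (hlt i hi)
    refine ⟨l', fun u => ?_, fun i hi a => ?_, fun x y hxy => ?_⟩
    · by_cases hu : u ∈ T
      · simp [l', hu]
      · have := hl u
        simp only [l', hu, if_false]
        omega
    · rw [← hgr i (by omega)]
      have hu' : ∀ u, l' u = i → u ∉ T ∧ l u = i := by
        intro u h
        have h1 : u ∉ T := fun h1 => by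
          have := (hT u).2 h1
          omega
        exact ⟨h1, by simpa [l', h1] using h⟩
      rcases Nat.lt_succ_iff_lt_or_eq.1 hi with hi | rfl
      · obtain ⟨v, hv⟩ := hcov i hi a
        exact ⟨v, fun u h1 h2 => hv u (hu' u h1).2 h2⟩
      · refine ⟨P ((levelGraph H l i).connectedComponentMk a) i, fun u h1 h2 => ?_⟩
        obtain ⟨h3, h4⟩ := hu' u h1
        by_contra h5
        rw [← SimpleGraph.ConnectedComponent.sound h2] at h5
        exact h3 ⟨h4, h5⟩
    · have hxT : x ∈ T := (hT x).1 (by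
        have := hxy.2.1
        by_cases hu : x ∈ T
        · simp [l', hu]
        · have := hl x
          simp only [l', hu, if_false] at *
          omega)
      have hle : levelGraph H l' (j + 1) ≤ levelGraph H l j := by
        rw [hgr j le_rfl]
        intro a b hab
        exact ⟨hab.1, by have := hab.2.1; omega, by have := hab.2.2; omega⟩
      have hacc' := hP _ x y rfl (hle hxy)
      set p := P ((levelGraph H l j).connectedComponentMk x)
      have hmemT : ∀ z, j + 1 ≤ l' z → z ∈ T := fun z hz => by
        by_contra hzT
        have := hl z
        simp only [l', hzT, if_false] at hz
        omega
      have hC' : ∀ z, (levelGraph H l' (j + 1)).Reachable x z → ¬ H.Adj (p j) z := by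
        intro z hz
        have hzT := hmemT z (le_level_of_reachable hz hxy.2.1)
        have hcomp : (levelGraph H l j).connectedComponentMk z =
            (levelGraph H l j).connectedComponentMk x :=
          SimpleGraph.ConnectedComponent.sound (hz.mono hle).symm
        have := hzT.2
        rwa [hcomp] at this
      -- A walk in the old component from `x` to a neighbor of `p j` must leave the new component.
      -- The vertex `u` where it leaves was not promoted, hence is adjacent to `p j` and prolongs
      -- the path.
      obtain ⟨c, hc, hpc⟩ := hacc'.2.1
      have hc' : ¬ (levelGraph H l' (j + 1)).Reachable x c := fun h => hC' c h hpc
      obtain ⟨w⟩ : (levelGraph H l j).Reachable x c := hc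
      obtain ⟨z, u, hxz, hzu, hz, hu⟩ :=
        exists_adj_of_walk (P := fun z => (levelGraph H l' (j + 1)).Reachable x z) w
          (SimpleGraph.Reachable.refl _) hc'
      have hxu : (levelGraph H l j).Reachable x u := hxz.trans hzu.reachable
      refine hacc'.extend (C' := {z | (levelGraph H l' (j + 1)).Reachable x z}) (u := u) (z := z)
        (fun a ha => SimpleGraph.Reachable.mono hle ha) hC' hxu ?_ hz hzu.1.symm
      by_contra hpu
      have hlu : l u = j := le_antisymm (hl u) hzu.2.2
      have huT : u ∈ T := by
        refine ⟨hlu, ?_⟩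
        rwa [← SimpleGraph.ConnectedComponent.sound hxu]
      apply hu
      refine SimpleGraph.Reachable.trans hz (SimpleGraph.Adj.reachable ⟨hzu.1, ?_, ?_⟩)
      · exact le_level_of_reachable hz hxy.2.1
      · exact ((hT u).2 huT).ge

/-- **Gyárfás path argument.** A graph without induced paths on `n` vertices has a partition into
levels `0, …, n` such that level `n` is independent and each component of the graph
induced by the levels `≥ j`, where `j < n`, meets the level `j` in a part of a neighborhood. -/
theorem exists_level (hH : ∀ p, ¬ IsInducedPath H n p) : ∃ l : V → ℕ,
    (∀ j < n, ∀ a, ∃ v, ∀ u, l u = j → (levelGraph H l j).Reachable u a → H.Adj v u) ∧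
    ∀ x y, H.Adj x y → l x < n ∨ l y < n := by
  obtain ⟨l, -, h2, h3⟩ := exists_level_accessPath H n
  refine ⟨l, h2, fun x y hxy => ?_⟩
  by_contra hlt
  obtain ⟨p, hp⟩ := h3 x y ⟨hxy, by omega, by omega⟩
  exact hH p (hp.1.mono (by omega))

end InducedPath

/-! ### Half-graphs and shattering rank -/

section Rank

variable {V : Type u} {G : SimpleGraph V}

/-- Distinctness within each side need not be assumed: the vertices of a side have pairwise
different neighborhoods on the other. -/
theorem isSemiInducedIn_halfGraph {k : ℕ} (a b : ℕ → V)
    (h : ∀ i < k, ∀ j < k, (G.Adj (a i) (b j) ↔ i ≤ j) ∧ a i ≠ b j) :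
    (halfGraph k).IsSemiInducedIn G := by
  have ha : ∀ i < k, ∀ j < k, a i = a j → i = j := by
    intro i hi j hj hij
    have h1 := (h i hi j hj).1
    have h2 := (h j hj i hi).1
    have h3 := (h i hi i hi).1
    have h4 := (h j hj j hj).1
    rw [hij] at h1 h3
    exact le_antisymm (h1.1 (h4.2 le_rfl)) (h2.1 (h3.2 le_rfl))
  have hb : ∀ i < k, ∀ j < k, b i = b j → i = j := by
    intro i hi j hj hij
    have h1 := (h i hi j hj).1
    have h2 := (h j hj i hi).1
    have h3 := (h i hi i hi).1
    have h4 := (h j hj j hj).1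
    rw [hij] at h2 h3
    exact le_antisymm (h1.1 (h3.2 le_rfl)) (h2.1 (h4.2 le_rfl))
  refine (halfGraph k).isSemiInducedIn_of_injective G
    (Sum.elim (fun i => a i.1) (fun i => b i.1)) ?_ ?_
  · rintro (i | i) (j | j) hij
    · exact congrArg _ (Fin.ext (ha i i.2 j j.2 hij))
    · exact absurd hij (h i i.2 j j.2).2
    · exact absurd hij.symm (h j j.2 i i.2).2
    · exact congrArg _ (Fin.ext (hb i i.2 j j.2 hij))
  · rintro x ⟨i, rfl⟩ (j | j) hj
    · exact absurd ⟨j, rfl⟩ hj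
    · simp only [Sum.elim_inl, Sum.elim_inr, (h i i.2 j j.2).1]
      change (SimpleGraph.fromRel _).Adj _ _ ↔ _
      simp [SimpleGraph.fromRel_adj]

/-- A set `X` has rank at least `n` with respect to the set of tests `Y` if there is a complete
binary tree of height `n` of splittings of `X` by neighborhoods of vertices of `Y`. -/
def HasRank (G : SimpleGraph V) : ℕ → Set V → Set V → Prop
  | 0, X, _ => X.Nonempty
  | n + 1, X, Y => ∃ y ∈ Y, HasRank G n (X ∩ G.neighborSet y) Y ∧
      HasRank G n (X \ G.neighborSet y) Y

namespace HasRank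

variable {n : ℕ} {X X' Y Y' : Set V}

theorem mono (h : HasRank G n X Y) (hX : X ⊆ X') (hY : Y ⊆ Y') : HasRank G n X' Y' := by
  induction n generalizing X X' with
  | zero => exact Set.Nonempty.mono hX h
  | succ n ih =>
    obtain ⟨y, hy, h1, h2⟩ := h
    exact ⟨y, hY hy, ih h1 (Set.inter_subset_inter_left _ hX), ih h2 (Set.sdiff_subset_sdiff_left hX)⟩

theorem pred (h : HasRank G (n + 1) X Y) : HasRank G n X Y := by
  obtain ⟨y, hy, h1, -⟩ := h
  exact h1.mono Set.inter_subset_left subset_rfl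

theorem antitone {m : ℕ} (h : HasRank G n X Y) (hm : m ≤ n) : HasRank G m X Y := by
  induction n, hm using Nat.le_induction with
  | base => exact h
  | succ n _ ih => exact ih h.pred

theorem nonempty (h : HasRank G n X Y) : X.Nonempty :=
  h.antitone (Nat.zero_le n)

/-- At a lowest splitting the two parts are disjoint and nonempty, so one of them has a point other
than `a`; giving up that splitting pays for the deletion. -/
theorem sdiff_singleton (h : HasRank G (n + 1) X Y) (a : V) : HasRank G n (X \ {a}) Y := by
  induction n generalizing X with
  | zero =>
    obtain ⟨y, -, ⟨u, hu, hyu⟩, ⟨v, hv, hyv⟩⟩ := h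
    by_cases hua : u = a
    · refine ⟨v, hv, ?_⟩
      rintro rfl
      subst hua
      exact hyv hyu
    · exact ⟨u, hu, hua⟩
  | succ n ih =>
    obtain ⟨y, hy, h1, h2⟩ := h
    refine ⟨y, hy, (ih h1).mono ?_ subset_rfl, (ih h2).mono ?_ subset_rfl⟩
    · rintro x ⟨⟨h1, h2⟩, h3⟩
      exact ⟨⟨h1, h3⟩, h2⟩
    · rintro x ⟨⟨h1, h2⟩, h3⟩
      exact ⟨⟨h1, h3⟩, h2⟩

/-- Ramsey property of binary trees, for trees of splittings. -/
theorem or_of_subset_union {Y₀ Y₁ : Set V} (hY : Y ⊆ Y₀ ∪ Y₁) {p q : ℕ}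
    (h : HasRank G (p + q) X Y) : HasRank G p X Y₀ ∨ HasRank G q X Y₁ := by
  generalize hn : p + q = n at h
  induction n generalizing p q X with
  | zero =>
    obtain rfl : p = 0 := by omega
    exact Or.inl h
  | succ n ih =>
    rcases p with _ | p
    · exact Or.inl h.nonempty
    rcases q with _ | q
    · exact Or.inr h.nonempty
    obtain ⟨y, hy, h1, h2⟩ := h
    rcases hY hy with hy | hy
    · rcases ih (p := p) (q := q + 1) (by omega) h1 with h3 | h3
      · rcases ih (p := p) (q := q + 1) (by omega) h2 with h4 | h4
        · exact Or.inl ⟨y, hy, h3, h4⟩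
        · exact Or.inr (h4.mono Set.sdiff_subset subset_rfl)
      · exact Or.inr (h3.mono Set.inter_subset_left subset_rfl)
    · rcases ih (p := p + 1) (q := q) (by omega) h1 with h3 | h3
      · exact Or.inl (h3.mono Set.inter_subset_left subset_rfl)
      · rcases ih (p := p + 1) (q := q) (by omega) h2 with h4 | h4
        · exact Or.inl (h4.mono Set.sdiff_subset subset_rfl)
        · exact Or.inr ⟨y, hy, h3, h4⟩

/-- Splitting a second time by the same vertex leaves an empty part. -/
theorem not_two_singleton {a : V} : ¬ HasRank G 2 X {a} := by
  rintro ⟨y, rfl, ⟨z, rfl, -, ⟨x, hx⟩⟩, -⟩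
  exact hx.2 hx.1.2

end HasRank

end Rank

/-- A Ramsey-type recursion on the two target orders. Fix a point `x` of `X` and separate the tests
into neighbors and non-neighbors of `x`. One kind supports a tall tree; `x` and the root `y` of that
tree become the first pair, and the recursion continues in the part of `X` on the side of `y`
opposite to `x`. -/
theorem exists_halfGraph_of_hasRank (i j : ℕ) :
    ∃ N, ∀ (V : Type u) (G : SimpleGraph V) (X Y : Set V), HasRank G N X Y →
    (∃ x y : ℕ → V, (∀ a < i, x a ∈ X ∧ y a ∈ Y) ∧
      ∀ a < i, ∀ b < i, (G.Adj (x a) (y b) ↔ a ≤ b) ∧ x a ≠ y b) ∨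
    (∃ x y : ℕ → V, (∀ a < j, x a ∈ X ∧ y a ∈ Y) ∧
      ∀ a < j, ∀ b < j, (G.Adj (x a) (y b) ↔ b < a) ∧ x a ≠ y b) := by
  induction i generalizing j with
  | zero =>
    exact ⟨0, fun V G X Y h => Or.inl ⟨fun _ => h.some, fun _ => h.some, by simp, by simp⟩⟩
  | succ i ihi =>
    induction j with
    | zero =>
      exact ⟨0, fun V G X Y h => Or.inr ⟨fun _ => h.some, fun _ => h.some, by simp, by simp⟩⟩
    | succ j ihj =>
      obtain ⟨M₁, hM₁⟩ := ihi (j + 1)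
      obtain ⟨M₂, hM₂⟩ := ihj
      set M := max M₁ M₂
      -- Among neighbors of `x`, one level is spent on the root `y` and one on deleting `y` from
      -- `X`. Among non-neighbors, two levels are spent on excluding `x` as a test and one on the
      -- root.
      refine ⟨(M + 2) + ((M + 1) + 2), fun V G X Y h => ?_⟩
      obtain ⟨x, hx⟩ := h.nonempty
      rcases h.or_of_subset_union (Y₀ := Y ∩ G.neighborSet x) (Y₁ := Y \ G.neighborSet x)
        (by rw [Set.inter_union_sdiff]) with h | h
      · obtain ⟨y, hy, -, h⟩ := h
        have hxy : G.Adj x y := hy.2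
        rcases hM₁ _ _ _ _ ((h.sdiff_singleton y).antitone (le_max_left M₁ M₂)) with
          ⟨x', y', hmem, hadj⟩ | ⟨x', y', hmem, hadj⟩
        · refine Or.inl ⟨fun n => Nat.casesOn n x x', fun n => Nat.casesOn n y y', ?_, ?_⟩
          · rintro (_ | a) ha
            · exact ⟨hx, hy.1⟩
            · have := hmem a (by omega)
              exact ⟨this.1.1.1, this.2.1⟩
          · rintro (_ | a) ha (_ | b) hb
            · simpa using ⟨hxy, hxy.ne⟩
            · have : G.Adj x (y' b) := (hmem b (by omega)).2.2
              simpa using ⟨this, this.ne⟩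
            · have h1 := (hmem a (by omega)).1
              have h2 : ¬ G.Adj (x' a) y := fun h => h1.1.2 h.symm
              have h3 : x' a ≠ y := h1.2
              simpa using ⟨h2, h3⟩
            · simpa using hadj a (by omega) b (by omega)
        · exact Or.inr ⟨x', y', fun a ha => ⟨(hmem a ha).1.1.1, (hmem a ha).2.1⟩, hadj⟩
      · rw [add_comm] at h
        have hsub : Y \ G.neighborSet x ⊆ {x} ∪ (Y \ G.neighborSet x) \ {x} := by
          intro z hz
          by_cases hzx : z = x
          · exact Or.inl hzx
          · exact Or.inr ⟨hz, hzx⟩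
        obtain ⟨y, hy, h, -⟩ :=
          (h.or_of_subset_union hsub).resolve_left HasRank.not_two_singleton
        have hxy : ¬ G.Adj x y := hy.1.2
        have hne : x ≠ y := fun h => hy.2 h.symm
        rcases hM₂ _ _ _ _ (h.antitone (le_max_right M₁ M₂)) with
          ⟨x', y', hmem, hadj⟩ | ⟨x', y', hmem, hadj⟩
        · exact Or.inl ⟨x', y', fun a ha => ⟨(hmem a ha).1.1, (hmem a ha).2.1.1⟩, hadj⟩
        · refine Or.inr ⟨fun n => Nat.casesOn n x x', fun n => Nat.casesOn n y y', ?_, ?_⟩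
          · rintro (_ | a) ha
            · exact ⟨hx, hy.1.1⟩
            · have := hmem a (by omega)
              exact ⟨this.1.1, this.2.1.1⟩
          · rintro (_ | a) ha (_ | b) hb
            · simpa using ⟨hxy, hne⟩
            · have h1 := (hmem b (by omega)).2
              have h2 : ¬ G.Adj x (y' b) := h1.1.2
              have h3 : x ≠ y' b := fun h => h1.2 h.symm
              simpa using ⟨h2, h3⟩
            · have : G.Adj (x' a) y := ((hmem a (by omega)).1.2 : G.Adj y (x' a)).symm
              simpa using ⟨this, this.ne⟩
            · simpa using hadj a (by omega) b (by omega)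

theorem exists_not_hasRank (k : ℕ) : ∃ N, ∀ (V : Type u) (G : SimpleGraph V),
    ¬ (halfGraph k).IsSemiInducedIn G → ∀ X Y : Set V, ¬ HasRank G N X Y := by
  -- The strict pattern becomes the non-strict one after shifting one side by an index, which costs
  -- one pair.
  obtain ⟨N, hN⟩ := exists_halfGraph_of_hasRank.{u} k (k + 1)
  refine ⟨N, fun V G hG X Y h => ?_⟩
  rcases hN V G X Y h with ⟨x, y, -, hxy⟩ | ⟨x, y, -, hxy⟩
  · exact hG (isSemiInducedIn_halfGraph x y hxy)
  · refine hG (isSemiInducedIn_halfGraph y (fun b => x (b + 1)) fun i hi j hj => ⟨?_, ?_⟩)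
    · rw [G.adj_comm, (hxy (j + 1) (by omega) i (by omega)).1]
      omega
    · exact (hxy (j + 1) (by omega) i (by omega)).2.symm

section Cover

variable {V : Type u} {G : SimpleGraph V}

/-- If there is no large half-graph between disjoint sets `X` and `Y` then either `X` is covered
by few non-neighborhoods of vertices of `Y` or `Y` is covered by few neighborhoods of vertices
of `X`. -/
theorem exists_cover_of_not_halfGraph [Nonempty V] {k : ℕ} (hG : ¬ (halfGraph k).IsSemiInducedIn G)
    {X Y : Set V} (hXY : Disjoint X Y) :
    (∃ y : ℕ → V, ∀ x ∈ X, ∃ j ≤ k, y j ∈ Y ∧ ¬ G.Adj (y j) x) ∨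
    (∃ x : ℕ → V, ∀ y ∈ Y, ∃ j ≤ k, x j ∈ X ∧ G.Adj (x j) y) := by
  by_contra! hcon
  obtain ⟨h1, h2⟩ := hcon
  obtain ⟨v⟩ := ‹Nonempty V›
  -- If neither cover exists, pairs can be chosen greedily: a new `x'` adjacent to all earlier `y`,
  -- then a new `y'` adjacent to none of the chosen `x`, including `x'`.
  have key : ∀ n ≤ k + 1, ∃ x y : ℕ → V, (∀ a < n, x a ∈ X ∧ y a ∈ Y) ∧
      ∀ a < n, ∀ b < n, (G.Adj (x a) (y b) ↔ b < a) := by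
    intro n hn
    induction n with
    | zero => exact ⟨fun _ => v, fun _ => v, by simp, by simp⟩
    | succ n ih =>
      obtain ⟨x, y, hmem, hadj⟩ := ih (by omega)
      obtain ⟨x', hx', hx'y⟩ := h1 y
      obtain ⟨y', hy', hy'x⟩ := h2 (Function.update x n x')
      have hxn : Function.update x n x' n = x' := Function.update_self _ _ _
      have hyn : Function.update y n y' n = y' := Function.update_self _ _ _
      have hxl : ∀ a < n, Function.update x n x' a = x a := fun a ha =>
        Function.update_of_ne (by omega) _ _
      have hyl : ∀ a < n, Function.update y n y' a = y a := fun a ha =>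
        Function.update_of_ne (by omega) _ _
      have hmem' : ∀ a ≤ n, Function.update x n x' a ∈ X := by
        intro a ha
        rcases ha.lt_or_eq with ha | rfl
        · rw [hxl a ha]
          exact (hmem a ha).1
        · rwa [hxn]
      refine ⟨Function.update x n x', Function.update y n y', fun a ha => ?_, ?_⟩
      · refine ⟨hmem' a (by omega), ?_⟩
        rcases Nat.lt_succ_iff_lt_or_eq.1 ha with ha | rfl
        · rw [hyl a ha]
          exact (hmem a ha).2
        · rwa [hyn]
      · intro a ha b hb
        rcases Nat.lt_succ_iff_lt_or_eq.1 hb with hb | rfl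
        · rw [hyl b hb]
          rcases Nat.lt_succ_iff_lt_or_eq.1 ha with ha | rfl
          · rw [hxl a ha]
            exact hadj a ha b hb
          · rw [hxn]
            exact iff_of_true (hx'y b (by omega) (hmem b hb).2).symm hb
        · rw [hyn]
          exact iff_of_false (hy'x a (by omega) (hmem' a (by omega))) (by omega)
  obtain ⟨x, y, hmem, hadj⟩ := key (k + 1) le_rfl
  refine hG (isSemiInducedIn_halfGraph y (fun b => x (b + 1)) fun i hi j hj => ⟨?_, ?_⟩)
  · rw [G.adj_comm, hadj (j + 1) (by omega) i (by omega)]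
    omega
  · exact (hXY.ne_of_mem (hmem (j + 1) (by omega)).1 (hmem i (by omega)).2).symm

end Cover

/-! ### Reduction to equivalence relations -/

section Cross

variable {V : Type u} {G : SimpleGraph V} {F : Prop} {r : Setoid V} {X Y : Set V}

/-- The graph of the pairs in `X × Y` that are equivalent, distinct, and whose adjacency status
in `G` is `F`. -/
def crossGraph (G : SimpleGraph V) (F : Prop) (r : Setoid V) (X Y : Set V) : SimpleGraph V where
  Adj x y := x ≠ y ∧ r x y ∧ (G.Adj x y ↔ F) ∧ (x ∈ X ∧ y ∈ Y ∨ y ∈ X ∧ x ∈ Y)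
  symm := ⟨fun x y h => ⟨h.1.symm, r.symm h.2.1, by rw [G.adj_comm]; exact h.2.2.1, h.2.2.2.symm⟩⟩
  loopless := ⟨fun _ h => h.1 rfl⟩

theorem crossGraph_adj {x y : V} : (crossGraph G F r X Y).Adj x y ↔
    x ≠ y ∧ r x y ∧ (G.Adj x y ↔ F) ∧ (x ∈ X ∧ y ∈ Y ∨ y ∈ X ∧ x ∈ Y) :=
  Iff.rfl

theorem crossGraph_comm : crossGraph G F r X Y = crossGraph G F r Y X := by
  ext x y
  simp only [crossGraph_adj]
  tauto

theorem mem_of_crossGraph_adj (hXY : X = Y ∨ Disjoint X Y) {x y : V}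
    (h : (crossGraph G F r X Y).Adj x y) (hy : y ∈ X) : x ∈ Y := by
  rcases h.2.2.2 with ⟨h1, h2⟩ | ⟨-, h⟩
  · rcases hXY with rfl | hd
    · exact h1
    · exact absurd h2 (Set.disjoint_left.1 hd hy)
  · exact h

theorem rel_of_reachable_levelGraph {l : V → ℕ} {j : ℕ} {x y : V}
    (h : (levelGraph (crossGraph G F r X Y) l j).Reachable x y) : r x y := by
  obtain ⟨w⟩ := h
  induction w with
  | nil => exact r.refl _
  | cons h _ ih => exact r.trans h.1.2.1 ih

/-- The path alternates between `X` and `Y` and stays in one class of `r`. For vertices of different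
parity the remaining conditions of `crossGraph` are thus automatic, and an induced path there is a
semi-induced path or co-path of `G`. -/
theorem adj_iff_of_isInducedPath_crossGraph (hXY : X = Y ∨ Disjoint X Y) {n : ℕ} {p : ℕ → V}
    (hp : IsInducedPath (crossGraph G F r X Y) n p) {a b : ℕ} (ha : a < n) (hb : b < n)
    (hae : Even a) (hbo : ¬ Even b) :
    (crossGraph G F r X Y).Adj (p a) (p b) ↔ (G.Adj (p a) (p b) ↔ F) := by
  wlog h0 : p 0 ∈ X generalizing X Y with hwlog
  · have h1 : p 0 ∈ Y := by
      have h01 : (crossGraph G F r X Y).Adj (p 0) (p 1) :=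
        (hp 0 (by omega) 1 (by rcases b with _ | b; exacts [(hbo Even.zero).elim, by omega])).1.2
          (Or.inl rfl)
      rcases h01.2.2.2 with h | h
      · exact absurd h.1 h0
      · exact h.2
    rw [crossGraph_comm] at hp ⊢
    exact hwlog (hXY.imp Eq.symm fun h => h.symm) hp h1
  have hstep : ∀ c, c + 1 < n → (crossGraph G F r X Y).Adj (p c) (p (c + 1)) := fun c hc =>
    (hp c (by omega) (c + 1) hc).1.2 (Or.inl rfl)
  have hmem : ∀ c < n, (Even c → p c ∈ X) ∧ (¬ Even c → p c ∈ Y) := by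
    intro c hc
    induction c with
    | zero => exact ⟨fun _ => h0, fun h => absurd Even.zero h⟩
    | succ c ih =>
      have h1 := hstep c hc
      obtain ⟨h2, h3⟩ := ih (by omega)
      rw [Nat.even_add_one]
      refine ⟨fun hc => ?_, fun hc => ?_⟩
      · rw [crossGraph_comm] at h1
        exact mem_of_crossGraph_adj (hXY.imp Eq.symm fun h => h.symm) h1.symm (h3 hc)
      · exact mem_of_crossGraph_adj hXY h1.symm (h2 (not_not.1 hc))
  have hr : ∀ c < n, r (p 0) (p c) := by
    intro c hc
    induction c with
    | zero => exact r.refl _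
    | succ c ih => exact r.trans (ih (by omega)) (hstep c hc).2.1
  rw [crossGraph_adj]
  refine ⟨fun h => h.2.2.1, fun h => ⟨fun hab => ?_, ?_, h, ?_⟩⟩
  · rw [(hp a ha b hb).2 hab] at hae
    exact hbo hae
  · exact r.trans (r.symm (hr a ha)) (hr b hb)
  · exact Or.inl ⟨(hmem a ha).1 hae, (hmem b hb).2 hbo⟩

end Cross

variable {ι : Type v} {V : ι → Type u} {G : ∀ i, SimpleGraph (V i)}

theorem IsEncoded.conv {R : ∀ i, V i → V i → Prop} (h : IsEncoded G R) :
    IsEncoded G (fun i x y => R i y x) := by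
  obtain ⟨l, h1, h2⟩ := h
  exact ⟨l, h1, fun D hD => (h2 D hD).conv⟩

/-- Walks of a fixed length are definable by iterated composition, and lengths below `n` suffice. -/
theorem IsDefinable.reachable {H : ∀ i, SimpleGraph (V i)} {n : ℕ}
    (hH : IsDefinable G fun i x y => (H i).Adj x y)
    (hpath : ∀ i, ∀ p, ¬ IsInducedPath (H i) n p) :
    IsDefinable G fun i x y => (H i).Reachable x y := by
  have hwalk : ∀ m, IsDefinable G fun i x y => ∃ w : (H i).Walk x y, w.length = m := by
    intro m
    induction m with
    | zero =>
      refine (IsDefinable.eq G).congr fun i x y => ⟨?_, ?_⟩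
      · rintro ⟨w, hw⟩
        exact SimpleGraph.Walk.eq_of_length_eq_zero hw
      · rintro rfl
        exact ⟨.nil, rfl⟩
    | succ m ih =>
      refine (hH.comp ih).congr fun i x y => ⟨?_, ?_⟩
      · rintro ⟨_ | ⟨h, w⟩, hw⟩
        · simp at hw
        · exact ⟨_, h, w, by simpa using hw⟩
      · rintro ⟨z, h, w, hw⟩
        exact ⟨.cons h w, by simpa using hw⟩
  refine (IsDefinable.exists_lt n fun m _ => hwalk m).congr fun i x y => ⟨fun h => ?_, ?_⟩
  · obtain ⟨w, hw⟩ := exists_walk_length_lt_of_reachable (hpath i) h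
    exact ⟨_, hw, w, rfl⟩
  · rintro ⟨m, -, w, -⟩
    exact w.reachable

/-- Adjacency between two sets, inside the classes of a definable equivalence relation, can be
encoded whenever the ranks of the sets in each class are less than `n` and `m`. -/
def IsReducible (G : ∀ i, SimpleGraph (V i)) (n m : ℕ) : Prop :=
  ∀ (X Y : ∀ i, Set (V i)) (r : ∀ i, Setoid (V i)), IsDefinable G (fun i x y => r i x y) →
    (∀ i a, ¬ HasRank (G i) n (X i ∩ {x | r i x a}) (Y i ∩ {y | r i y a})) →
    (∀ i a, ¬ HasRank (G i) m (Y i ∩ {y | r i y a}) (X i ∩ {x | r i x a})) →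
    ((X = Y ∧ n = m) ∨ ∀ i, Disjoint (X i) (Y i)) →
    IsEncoded G fun i x y => x ∈ X i ∧ y ∈ Y i ∧ r i x y ∧ (G i).Adj x y

theorem IsReducible.symm {n m : ℕ} (h : IsReducible G n m) : IsReducible G m n := by
  intro X Y r hr hX hY hXY
  refine (h Y X r hr hY hX ?_).conv.congr fun i x y => ?_
  · exact hXY.imp (fun h => ⟨h.1.symm, h.2.symm⟩) fun h i => (h i).symm
  · constructor
    · exact fun ⟨h1, h2, h3, h4⟩ => ⟨h2, h1, (r i).symm h3, h4.symm⟩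
    · exact fun ⟨h1, h2, h3, h4⟩ => ⟨h2, h1, (r i).symm h3, h4.symm⟩

/-- Inside a component, level `j` is contained in the `crossGraph`-neighborhood of `v`. When it
meets `X`, the vertex `v` lies in `Y`, and the rank bound assumed for `v` applies. -/
theorem not_hasRank_level {W : Type u} {G : SimpleGraph W} {F : Prop} {r : Setoid W} {X Y : Set W}
    (hXY : X = Y ∨ Disjoint X Y) {n : ℕ}
    (hX : ∀ v ∈ Y, ¬ HasRank G n (X ∩ {x | r x v} ∩ {x | G.Adj x v ↔ F}) (Y ∩ {y | r y v}))
    {l : W → ℕ} {j : ℕ} {a v : W}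
    (hv : ∀ u, l u = j → (levelGraph (crossGraph G F r X Y) l j).Reachable u a →
      (crossGraph G F r X Y).Adj v u) :
    ¬ HasRank G n
      (X ∩ {x | l x = j} ∩ {x | (levelGraph (crossGraph G F r X Y) l j).Reachable x a})
      (Y ∩ {y | (levelGraph (crossGraph G F r X Y) l j).Reachable y a}) := by
  intro h
  obtain ⟨u, ⟨hu1, hu2⟩, hu3⟩ := h.nonempty
  have hvu := hv u hu2 hu3
  have hle : ∀ x y, (levelGraph (crossGraph G F r X Y) l j).Reachable x y → r x y :=
    fun _ _ => rel_of_reachable_levelGraph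
  refine hX v (mem_of_crossGraph_adj hXY hvu hu1) (h.mono ?_ ?_)
  · rintro x ⟨⟨hx1, hx2⟩, hx3⟩
    have hvx := hv x hx2 hx3
    exact ⟨⟨hx1, r.symm hvx.2.1⟩, by rw [Set.mem_ofPred_eq, G.adj_comm]; exact hvx.2.2.1⟩
  · rintro y ⟨hy1, hy2⟩
    exact ⟨hy1, r.trans (hle _ _ hy2) (r.trans (r.symm (hle _ _ hu3)) (r.symm hvu.2.1))⟩

/-- With `F` true the edges are sparse in rank, with `F` false the non-edges are. The levels of the
Gyárfás argument split the pairs of that kind so that the rank bound of at least one side drops. -/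
theorem isEncoded_of_no_induced_path {n m K : ℕ} {F : Prop}
    (h₁ : IsReducible G n (m + 1)) (h₂ : IsReducible G (n + 1) m) (h₃ : IsReducible G n m)
    (hpath : F → ∀ i, ¬ (bipPath K).IsSemiInducedIn (G i))
    (hcopath : ¬ F → ∀ i, ¬ (bipPath K).bipCompl.IsSemiInducedIn (G i))
    {X Y : ∀ i, Set (V i)} {r : ∀ i, Setoid (V i)} (hr : IsDefinable G fun i x y => r i x y)
    (hXrank : ∀ i a, ¬ HasRank (G i) (n + 1) (X i ∩ {x | r i x a}) (Y i ∩ {y | r i y a}))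
    (hYrank : ∀ i a, ¬ HasRank (G i) (m + 1) (Y i ∩ {y | r i y a}) (X i ∩ {x | r i x a}))
    (hXY : (X = Y ∧ n + 1 = m + 1) ∨ ∀ i, Disjoint (X i) (Y i))
    (hX : ∀ i, ∀ v ∈ Y i, ¬ HasRank (G i) n (X i ∩ {x | r i x v} ∩ {x | (G i).Adj x v ↔ F})
      (Y i ∩ {y | r i y v}))
    (hY : ∀ i, ∀ v ∈ X i, ¬ HasRank (G i) m (Y i ∩ {y | r i y v} ∩ {y | (G i).Adj y v ↔ F})
      (X i ∩ {x | r i x v})) :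
    IsEncoded G fun i x y => x ∈ X i ∧ y ∈ Y i ∧ r i x y ∧ (G i).Adj x y := by
  have hXY' : ∀ i, X i = Y i ∨ Disjoint (X i) (Y i) := fun i =>
    hXY.imp (fun h => congrFun h.1 i) fun h => h i
  let H : ∀ i, SimpleGraph (V i) := fun i => crossGraph (G i) F (r i) (X i) (Y i)
  have hH : ∀ i p, ¬ IsInducedPath (H i) K p := by
    intro i p hp
    by_cases hF : F
    · refine hpath hF i (isSemiInducedIn_bipPath hp fun a ha b hb hae hbo => ?_)
      rw [adj_iff_of_isInducedPath_crossGraph (hXY' i) hp ha hb hae hbo]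
      tauto
    · refine hcopath hF i (isSemiInducedIn_bipCompl_bipPath hp fun a ha b hb hae hbo => ?_)
      rw [adj_iff_of_isInducedPath_crossGraph (hXY' i) hp ha hb hae hbo]
      tauto
  choose l hl₁ hl₂ using fun i => exists_level (hH i)
  let ρ : ℕ → ∀ i, Setoid (V i) := fun j i => (levelGraph (H i) (l i) j).reachableSetoid
  have hF : IsDefinable G fun i x y => ((G i).Adj x y ↔ F) := by
    by_cases hF : F
    · exact (IsDefinable.adj G).congr fun i x y => by tauto
    · exact (IsDefinable.adj G).not.congr fun i x y => by tauto
  have hHdef : IsDefinable G fun i x y => (H i).Adj x y :=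
    (IsDefinable.eq G).not.and (hr.and (hF.and
      (((IsDefinable.memLeft G X).and (IsDefinable.memRight G Y)).or
        ((IsDefinable.memRight G X).and (IsDefinable.memLeft G Y)))))
  have hρ : ∀ j, IsDefinable G fun i x y => ρ j i x y := by
    intro j
    -- A path with at least two vertices is needed to force them onto the levels from `j` up, hence
    -- the maximum with `2`.
    refine IsDefinable.reachable (H := fun i => levelGraph (H i) (l i) j) (n := max K 2)
      (hHdef.and ((IsDefinable.memLeft G fun i => {x | j ≤ l i x}).and
        (IsDefinable.memRight G fun i => {x | j ≤ l i x}))) fun i p hp => ?_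
    exact hH i p ((hp.of_levelGraph (le_max_right _ _)).mono (le_max_left _ _))
  have hρr : ∀ j i x y, ρ j i x y → r i x y := fun _ _ _ _ =>
    rel_of_reachable_levelGraph
  have hXj : ∀ j < K, ∀ i a, ¬ HasRank (G i) n (X i ∩ {x | l i x = j} ∩ {x | ρ j i x a})
      (Y i ∩ {y | ρ j i y a}) := by
    intro j hj i a
    obtain ⟨v, hv⟩ := hl₁ i j hj a
    exact not_hasRank_level (hXY' i) (hX i) hv
  have hYj : ∀ j < K, ∀ i a, ¬ HasRank (G i) m (Y i ∩ {y | l i y = j} ∩ {y | ρ j i y a})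
      (X i ∩ {x | ρ j i x a}) := by
    intro j hj i a
    obtain ⟨v, hv⟩ := hl₁ i j hj a
    have hc : H i = crossGraph (G i) F (r i) (Y i) (X i) := crossGraph_comm
    rw [hc] at hv
    have := not_hasRank_level ((hXY' i).imp Eq.symm fun h => h.symm) (hY i) hv
    rwa [← hc] at this
  -- Equivalent pairs under `ρ j` whose lower level is exactly `j`; every edge of `H` from `X` to
  -- `Y` falls into one of these with `j < K`.
  let T : ℕ → ∀ i, V i → V i → Prop := fun j i x y => x ∈ X i ∧ y ∈ Y i ∧ ρ j i x y ∧
    (l i x = j ∧ j ≤ l i y ∨ j ≤ l i x ∧ l i y = j)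
  have hT : ∀ j, IsEncoded G (T j) := fun j =>
    (IsEncoded.memLeft G X).and ((IsEncoded.memRight G Y).and ((IsEncoded.setoid (r := ρ j) (hρ j)).and
      (((IsEncoded.memLeft G fun i => {x | l i x = j}).and
        (IsEncoded.memRight G fun i => {x | j ≤ l i x})).or
      ((IsEncoded.memLeft G fun i => {x | j ≤ l i x}).and
        (IsEncoded.memRight G fun i => {x | l i x = j})))))
  have hsub : ∀ {i : ι} {A B : Set (V i)} {a : V i} (j : ℕ), A ⊆ B →
      A ∩ {x | ρ j i x a} ⊆ B ∩ {x | r i x a} := fun j hAB x hx =>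
    ⟨hAB hx.1, hρr j _ _ _ hx.2⟩
  have hsub' : ∀ {i : ι} {A B : Set (V i)} {a : V i} (j : ℕ), A ⊆ B →
      A ∩ {x | ρ j i x a} ⊆ B ∩ {x | ρ j i x a} := fun j hAB x hx => ⟨hAB hx.1, hx.2⟩
  have hA : ∀ j < K, IsEncoded G fun i x y => T j i x y ∧ (G i).Adj x y := by
    intro j hj
    -- A side restricted to level `j` drops in rank. In `e₁` and `e₂` the levels differ, so the
    -- sides are disjoint even if `X = Y`; in `e₃` both bounds drop together, so equal sides keep
    -- equal bounds.
    have e₁ := h₁ (fun i => X i ∩ {x | l i x = j}) (fun i => Y i ∩ {y | j < l i y}) (ρ j) (hρ j)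
      (fun i a h => hXj j hj i a (h.mono subset_rfl (hsub' j Set.inter_subset_left)))
      (fun i a h => hYrank i a (h.mono (hsub j Set.inter_subset_left)
        (hsub j Set.inter_subset_left)))
      (Or.inr fun i => Set.disjoint_left.2 fun x h1 h2 => by
        have h3 : l i x = j := h1.2
        have h4 : j < l i x := h2.2
        omega)
    have e₂ := h₂ (fun i => X i ∩ {x | j < l i x}) (fun i => Y i ∩ {y | l i y = j}) (ρ j) (hρ j)
      (fun i a h => hXrank i a (h.mono (hsub j Set.inter_subset_left)
        (hsub j Set.inter_subset_left)))
      (fun i a h => hYj j hj i a (h.mono subset_rfl (hsub' j Set.inter_subset_left)))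
      (Or.inr fun i => Set.disjoint_left.2 fun x h1 h2 => by
        have h3 : j < l i x := h1.2
        have h4 : l i x = j := h2.2
        omega)
    have e₃ := h₃ (fun i => X i ∩ {x | l i x = j}) (fun i => Y i ∩ {y | l i y = j}) (ρ j) (hρ j)
      (fun i a h => hXj j hj i a (h.mono subset_rfl (hsub' j Set.inter_subset_left)))
      (fun i a h => hYj j hj i a (h.mono subset_rfl (hsub' j Set.inter_subset_left)))
      (hXY.imp (fun h => ⟨by rw [h.1], by omega⟩) fun h i =>
        (h i).mono Set.inter_subset_left Set.inter_subset_left)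
    refine ((e₁.or e₂).or e₃).congr fun i x y => ?_
    simp only [T, Set.mem_inter_iff, Set.mem_ofPred_eq]
    constructor
    · rintro ⟨⟨hx, hy, hxy, ⟨h1, h2⟩ | ⟨h1, h2⟩⟩, h3⟩
      · rcases h2.lt_or_eq with h2 | h2
        · exact Or.inl (Or.inl ⟨⟨hx, h1⟩, ⟨hy, h2⟩, hxy, h3⟩)
        · exact Or.inr ⟨⟨hx, h1⟩, ⟨hy, h2.symm⟩, hxy, h3⟩
      · rcases h1.lt_or_eq with h1 | h1
        · exact Or.inl (Or.inr ⟨⟨hx, h1⟩, ⟨hy, h2⟩, hxy, h3⟩)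
        · exact Or.inr ⟨⟨hx, h1.symm⟩, ⟨hy, h2⟩, hxy, h3⟩
    · rintro ((⟨⟨hx, h1⟩, ⟨hy, h2⟩, hxy, h3⟩ | ⟨⟨hx, h1⟩, ⟨hy, h2⟩, hxy, h3⟩) |
        ⟨⟨hx, h1⟩, ⟨hy, h2⟩, hxy, h3⟩)
      · exact ⟨⟨hx, hy, hxy, Or.inl ⟨h1, h2.le⟩⟩, h3⟩
      · exact ⟨⟨hx, hy, hxy, Or.inr ⟨h1.le, h2⟩⟩, h3⟩
      · exact ⟨⟨hx, hy, hxy, Or.inl ⟨h1, h2.ge⟩⟩, h3⟩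
  have hex : ∀ i x y, x ∈ X i → y ∈ Y i → (H i).Adj x y → ∃ j < K, T j i x y := by
    intro i x y hx hy hxy
    refine ⟨min (l i x) (l i y), ?_, hx, hy, ?_, ?_⟩
    · rcases hl₂ i x y hxy with h | h <;> omega
    · exact SimpleGraph.Adj.reachable ⟨hxy, min_le_left _ _, min_le_right _ _⟩
    · omega
  by_cases hF : F
  · refine (IsEncoded.exists_lt K hA).congr fun i x y => ⟨?_, ?_⟩
    · rintro ⟨hx, hy, hxy, hadj⟩
      obtain ⟨j, hj, hT⟩ := hex i x y hx hy
        ⟨hadj.ne, hxy, iff_of_true hadj hF, Or.inl ⟨hx, hy⟩⟩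
      exact ⟨j, hj, hT, hadj⟩
    · rintro ⟨j, -, hT, hadj⟩
      exact ⟨hT.1, hT.2.1, hρr j _ _ _ hT.2.2.1, hadj⟩
  -- The levels now capture the non-edges, so adjacency is obtained by removing them from the
  -- equivalent pairs of distinct vertices.
  · have hbad : IsEncoded G fun i x y => ∃ j < K, T j i x y ∧ ¬ (T j i x y ∧ (G i).Adj x y) :=
      IsEncoded.exists_lt K fun j hj => (hT j).and (hA j hj).not
    refine ((IsEncoded.memLeft G X).and ((IsEncoded.memRight G Y).and
      ((IsEncoded.setoid (r := r) hr).and ((IsEncoded.eq G).not.and hbad.not)))).congr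
      fun i x y => ⟨?_, ?_⟩
    · rintro ⟨hx, hy, hxy, hadj⟩
      exact ⟨hx, hy, hxy, hadj.ne, fun ⟨j, _, hT, hbad⟩ => hbad ⟨hT, hadj⟩⟩
    · rintro ⟨hx, hy, hxy, hne, hbad⟩
      refine ⟨hx, hy, hxy, by_contra fun hadj => hbad ?_⟩
      obtain ⟨j, hj, hT⟩ := hex i x y hx hy
        ⟨hne, hxy, iff_of_false hadj hF, Or.inl ⟨hx, hy⟩⟩
      exact ⟨j, hj, hT, fun h => hadj h.2⟩

/-- Level `j + 1` is assigned by the `j`-th covering set and level `0` to what remains. Within each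
class of `r` one of the two sides is fully covered, so no equivalent pair has both ends on level
`0`. -/
theorem exists_level_of_not_halfGraph {W : Type u} {G : SimpleGraph W} {k : ℕ}
    (hG : ¬ (halfGraph k).IsSemiInducedIn G) {X Y : Set W} (hXY : Disjoint X Y) (r : Setoid W)
    {n m : ℕ}
    (hX : ∀ v ∈ Y, ¬ HasRank G n ((X ∩ {x | r x v}) \ G.neighborSet v) (Y ∩ {y | r y v}))
    (hY : ∀ v ∈ X, ¬ HasRank G m (Y ∩ {y | r y v} ∩ G.neighborSet v) (X ∩ {x | r x v})) :
    ∃ l l' : W → ℕ, (∀ x, l x < k + 2) ∧ (∀ x, l' x < k + 2) ∧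
      (∀ p ≠ 0, ∀ a, ¬ HasRank G n (X ∩ {x | l x = p} ∩ {x | r x a}) (Y ∩ {y | r y a})) ∧
      (∀ p ≠ 0, ∀ a, ¬ HasRank G m (Y ∩ {y | l' y = p} ∩ {y | r y a}) (X ∩ {x | r x a})) ∧
      ∀ x ∈ X, ∀ y ∈ Y, r x y → l x ≠ 0 ∨ l' y ≠ 0 := by
  -- The covering vertices are chosen through a canonical representative, so that equivalent
  -- vertices use the same cover.
  let rep : W → W := fun a => (Quotient.mk r a).out
  have hrep : ∀ a, r (rep a) a := fun a => Quotient.mk_out (s := r) a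
  have hrep' : ∀ a b, r a b → rep a = rep b := fun a b h =>
    congrArg Quotient.out (Quotient.sound h)
  have hcov : ∀ a : W, ∃ y x : ℕ → W,
      (∀ x' ∈ X ∩ {x | r x a}, ∃ j ≤ k, y j ∈ Y ∩ {y | r y a} ∧ ¬ G.Adj (y j) x') ∨
      (∀ y' ∈ Y ∩ {y | r y a}, ∃ j ≤ k, x j ∈ X ∩ {x | r x a} ∧ G.Adj (x j) y') := by
    intro a
    have : Nonempty W := ⟨a⟩
    rcases exists_cover_of_not_halfGraph hG
      (hXY.mono (Set.inter_subset_left (t := {x | r x a})) (Set.inter_subset_left (t := {y | r y a})))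
      with ⟨y, hy⟩ | ⟨x, hx⟩
    · exact ⟨y, fun _ => a, Or.inl hy⟩
    · exact ⟨fun _ => a, x, Or.inr hx⟩
  choose y x hyx using hcov
  have hlev : ∀ P : W → ℕ → Prop, ∃ l : W → ℕ, (∀ z, l z < k + 2) ∧
      (∀ z j, l z = j + 1 → P z j) ∧ ∀ z, (∃ j ≤ k, P z j) → l z ≠ 0 := by
    intro P
    have : ∀ z, ∃ p < k + 2, (∀ j, p = j + 1 → P z j) ∧ ((∃ j ≤ k, P z j) → p ≠ 0) := by
      intro z
      by_cases h : ∃ j ≤ k, P z j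
      · obtain ⟨j, hj, hP⟩ := h
        exact ⟨j + 1, by omega, fun j' h => Nat.succ_injective h ▸ hP, by simp⟩
      · exact ⟨0, by omega, by simp, fun h' => absurd h' h⟩
    choose l h1 h2 h3 using this
    exact ⟨l, h1, h2, h3⟩
  obtain ⟨l, hl1, hl2, hl3⟩ := hlev fun z j =>
    y (rep z) j ∈ Y ∩ {y | r y (rep z)} ∧ ¬ G.Adj (y (rep z) j) z
  obtain ⟨l', hl1', hl2', hl3'⟩ := hlev fun z j =>
    x (rep z) j ∈ X ∩ {x | r x (rep z)} ∧ G.Adj (x (rep z) j) z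
  refine ⟨l, l', hl1, hl1', fun p hp a h => ?_, fun p hp a h => ?_, fun x' hx' y' hy' hxy => ?_⟩
  · obtain ⟨j, rfl⟩ := Nat.exists_eq_succ_of_ne_zero hp
    obtain ⟨u, ⟨-, hu2⟩, hu3⟩ := h.nonempty
    have hw := (hl2 u j hu2).1
    rw [hrep' u a hu3] at hw
    have hwa : r (y (rep a) j) a := r.trans hw.2 (hrep a)
    refine hX _ hw.1 (h.mono ?_ ?_)
    · rintro z ⟨⟨hz1, hz2⟩, hz3⟩
      have := (hl2 z j hz2).2
      rw [hrep' z a hz3] at this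
      exact ⟨⟨hz1, r.trans hz3 (r.symm hwa)⟩, this⟩
    · rintro z ⟨hz1, hz2⟩
      exact ⟨hz1, r.trans hz2 (r.symm hwa)⟩
  · obtain ⟨j, rfl⟩ := Nat.exists_eq_succ_of_ne_zero hp
    obtain ⟨u, ⟨-, hu2⟩, hu3⟩ := h.nonempty
    have hw := (hl2' u j hu2).1
    rw [hrep' u a hu3] at hw
    have hwa : r (x (rep a) j) a := r.trans hw.2 (hrep a)
    refine hY _ hw.1 (h.mono ?_ ?_)
    · rintro z ⟨⟨hz1, hz2⟩, hz3⟩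
      have := (hl2' z j hz2).2
      rw [hrep' z a hz3] at this
      exact ⟨⟨hz1, r.trans hz3 (r.symm hwa)⟩, this⟩
    · rintro z ⟨hz1, hz2⟩
      exact ⟨hz1, r.trans hz2 (r.symm hwa)⟩
  · rcases hyx (rep x') with h | h
    · exact Or.inl (hl3 x' (h x' ⟨hx', r.symm (hrep x')⟩))
    · refine Or.inr (hl3' y' ?_)
      rw [hrep' x' y' hxy] at h
      exact h y' ⟨hy', r.symm (hrep y')⟩

/-- Each pair of levels either contains no equivalent pair or has a nonzero level, on which the rank
bound has dropped. -/
theorem isEncoded_of_mixed {n m k : ℕ}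
    (h₁ : IsReducible G n (m + 1)) (h₂ : IsReducible G (n + 1) m)
    (hhalf : ∀ i, ¬ (halfGraph k).IsSemiInducedIn (G i))
    {X Y : ∀ i, Set (V i)} {r : ∀ i, Setoid (V i)} (hr : IsDefinable G fun i x y => r i x y)
    (hXrank : ∀ i a, ¬ HasRank (G i) (n + 1) (X i ∩ {x | r i x a}) (Y i ∩ {y | r i y a}))
    (hYrank : ∀ i a, ¬ HasRank (G i) (m + 1) (Y i ∩ {y | r i y a}) (X i ∩ {x | r i x a}))
    (hXY : ∀ i, Disjoint (X i) (Y i))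
    (hX : ∀ i, ∀ v ∈ Y i,
      ¬ HasRank (G i) n ((X i ∩ {x | r i x v}) \ (G i).neighborSet v) (Y i ∩ {y | r i y v}))
    (hY : ∀ i, ∀ v ∈ X i,
      ¬ HasRank (G i) m (Y i ∩ {y | r i y v} ∩ (G i).neighborSet v) (X i ∩ {x | r i x v})) :
    IsEncoded G fun i x y => x ∈ X i ∧ y ∈ Y i ∧ r i x y ∧ (G i).Adj x y := by
  choose l l' hl hl' hXl hYl hne using fun i =>
    exists_level_of_not_halfGraph (hhalf i) (hXY i) (r i) (hX i) (hY i)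
  have hsub : ∀ {i : ι} {A B : Set (V i)} {a : V i}, A ∩ B ∩ {x | r i x a} ⊆ A ∩ {x | r i x a} :=
    by
      intro i A B a
      exact Set.inter_subset_inter_left _ Set.inter_subset_left
  have hdis : ∀ p q i, Disjoint (X i ∩ {x | l i x = p}) (Y i ∩ {y | l' i y = q}) := fun p q i =>
    (hXY i).mono Set.inter_subset_left Set.inter_subset_left
  have hpq : ∀ p q, IsEncoded G fun i x y => x ∈ X i ∩ {x | l i x = p} ∧
      y ∈ Y i ∩ {y | l' i y = q} ∧ r i x y ∧ (G i).Adj x y := by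
    intro p q
    by_cases hp : p = 0
    · by_cases hq : q = 0
      · refine (IsEncoded.false G).congr fun i x y => ?_
        simp only [iff_false]
        rintro ⟨⟨hx, hxp⟩, ⟨hy, hyq⟩, hxy, -⟩
        subst p q
        exact (hne i x hx y hy hxy).elim (fun h => h hxp) fun h => h hyq
      · exact h₂ _ _ r hr (fun i a h => hXrank i a (h.mono hsub hsub))
          (fun i a h => hYl i q hq a (h.mono subset_rfl hsub)) (Or.inr (hdis p q))
    · exact h₁ _ _ r hr (fun i a h => hXl i p hp a (h.mono subset_rfl hsub))
        (fun i a h => hYrank i a (h.mono hsub hsub)) (Or.inr (hdis p q))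
  refine (IsEncoded.exists_lt (k + 2) fun p _ => IsEncoded.exists_lt (k + 2) fun q _ =>
    hpq p q).congr fun i x y => ⟨?_, ?_⟩
  · rintro ⟨hx, hy, h⟩
    exact ⟨_, hl i x, _, hl' i y, ⟨hx, rfl⟩, ⟨hy, rfl⟩, h⟩
  · rintro ⟨p, -, q, -, hx, hy, h⟩
    exact ⟨hx.1, hy.1, h⟩

theorem isReducible {s t k : ℕ} (hpath : ∀ i, ¬ (bipPath s).IsSemiInducedIn (G i))
    (hcopath : ∀ i, ¬ (bipPath t).bipCompl.IsSemiInducedIn (G i))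
    (hhalf : ∀ i, ¬ (halfGraph k).IsSemiInducedIn (G i)) (n m : ℕ) : IsReducible G n m := by
  induction hN : n + m using Nat.strong_induction_on generalizing n m with
  | _ N ih =>
  intro X Y r hr hXrank hYrank hXY
  rcases n with _ | n
  · refine (IsEncoded.false G).congr fun i x y => ⟨fun h => ?_, False.elim⟩
    exact hXrank i x ⟨x, h.1, (r i).refl x⟩
  rcases m with _ | m
  · refine (IsEncoded.false G).congr fun i x y => ⟨fun h => ?_, False.elim⟩
    exact hYrank i y ⟨y, h.2.1, (r i).refl y⟩
  have h₁ : IsReducible G n (m + 1) := ih _ (by omega) n (m + 1) rfl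
  have h₂ : IsReducible G (n + 1) m := ih _ (by omega) (n + 1) m rfl
  have h₃ : IsReducible G n m := ih _ (by omega) n m rfl
  -- Vertices with a neighborhood of small rank. For the others the non-neighborhood has small rank,
  -- since otherwise the vertex would split its own class on the opposite side into two parts of
  -- large rank.
  let X₀ : ∀ i, Set (V i) := fun i => {v | v ∈ X i ∧
    ¬ HasRank (G i) m (Y i ∩ {y | r i y v} ∩ (G i).neighborSet v) (X i ∩ {x | r i x v})}
  let Y₀ : ∀ i, Set (V i) := fun i => {v | v ∈ Y i ∧
    ¬ HasRank (G i) n (X i ∩ {x | r i x v} ∩ (G i).neighborSet v) (Y i ∩ {y | r i y v})}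
  let X₁ : ∀ i, Set (V i) := fun i => X i \ X₀ i
  let Y₁ : ∀ i, Set (V i) := fun i => Y i \ Y₀ i
  have hX₀ : ∀ i, X₀ i ⊆ X i := fun i v hv => hv.1
  have hY₀ : ∀ i, Y₀ i ⊆ Y i := fun i v hv => hv.1
  have hX₁ : ∀ i, X₁ i ⊆ X i := fun i v hv => hv.1
  have hY₁ : ∀ i, Y₁ i ⊆ Y i := fun i v hv => hv.1
  have hX₁' : ∀ i, ∀ v ∈ X₁ i, ¬ HasRank (G i) m
      ((Y i ∩ {y | r i y v}) \ (G i).neighborSet v) (X i ∩ {x | r i x v}) := by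
    intro i v hv h
    refine hYrank i v ⟨v, ⟨hv.1, (r i).refl v⟩, by_contra fun h' => hv.2 ⟨hv.1, h'⟩, h⟩
  have hY₁' : ∀ i, ∀ v ∈ Y₁ i, ¬ HasRank (G i) n
      ((X i ∩ {x | r i x v}) \ (G i).neighborSet v) (Y i ∩ {y | r i y v}) := by
    intro i v hv h
    refine hXrank i v ⟨v, ⟨hv.1, (r i).refl v⟩, by_contra fun h' => hv.2 ⟨hv.1, h'⟩, h⟩
  have hXA : ∀ {A B : ∀ i, Set (V i)}, (∀ i, A i ⊆ X i) → (∀ i, B i ⊆ Y i) →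
      ∀ i a, ¬ HasRank (G i) (n + 1) (A i ∩ {x | r i x a}) (B i ∩ {y | r i y a}) :=
    fun hA hB i a h => hXrank i a
      (h.mono (Set.inter_subset_inter_left _ (hA i)) (Set.inter_subset_inter_left _ (hB i)))
  have hYB : ∀ {A B : ∀ i, Set (V i)}, (∀ i, A i ⊆ X i) → (∀ i, B i ⊆ Y i) →
      ∀ i a, ¬ HasRank (G i) (m + 1) (B i ∩ {x | r i x a}) (A i ∩ {y | r i y a}) :=
    fun hA hB i a h => hYrank i a
      (h.mono (Set.inter_subset_inter_left _ (hB i)) (Set.inter_subset_inter_left _ (hA i)))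
  -- If `X = Y`, the equal rank bounds make the two splittings coincide. This yields the
  -- disjointness needed in the mixed cases.
  have hsame : X = Y ∧ n + 1 = m + 1 → X₀ = Y₀ := by
    rintro ⟨rfl, h⟩
    obtain rfl : n = m := by omega
    rfl
  have hd₁ : ∀ i, Disjoint (X₀ i) (Y₁ i) := by
    intro i
    rcases hXY with h | h
    · rw [hsame h]
      exact Set.disjoint_sdiff_right
    · exact (h i).mono (hX₀ i) (hY₁ i)
  have hd₂ : ∀ i, Disjoint (Y₀ i) (X₁ i) := by
    intro i
    rcases hXY with h | h
    · rw [← hsame h]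
      exact Set.disjoint_sdiff_right
    · exact (h i).symm.mono (hY₀ i) (hX₁ i)
  have e₀₀ : IsEncoded G fun i x y => x ∈ X₀ i ∧ y ∈ Y₀ i ∧ r i x y ∧ (G i).Adj x y := by
    refine isEncoded_of_no_induced_path (F := True) (K := s) h₁ h₂ h₃ (fun _ => hpath)
      (fun h => absurd trivial h) hr (hXA hX₀ hY₀) (hYB hX₀ hY₀)
      (hXY.imp (fun h => ⟨hsame h, h.2⟩) fun h i => (h i).mono (hX₀ i) (hY₀ i)) ?_ ?_
    · intro i v hv h
      refine hv.2 (h.mono ?_ (Set.inter_subset_inter_left _ (hY₀ i)))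
      rintro x ⟨⟨hx1, hx2⟩, hx3⟩
      exact ⟨⟨hX₀ i hx1, hx2⟩, (hx3.2 trivial).symm⟩
    · intro i v hv h
      refine hv.2 (h.mono ?_ (Set.inter_subset_inter_left _ (hX₀ i)))
      rintro x ⟨⟨hx1, hx2⟩, hx3⟩
      exact ⟨⟨hY₀ i hx1, hx2⟩, (hx3.2 trivial).symm⟩
  have e₁₁ : IsEncoded G fun i x y => x ∈ X₁ i ∧ y ∈ Y₁ i ∧ r i x y ∧ (G i).Adj x y := by
    refine isEncoded_of_no_induced_path (F := False) (K := t) h₁ h₂ h₃ (fun h => h.elim)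
      (fun _ => hcopath) hr (hXA hX₁ hY₁) (hYB hX₁ hY₁)
      (hXY.imp (fun h => ⟨?_, h.2⟩) fun h i => (h i).mono (hX₁ i) (hY₁ i)) ?_ ?_
    · have h' := hsame h
      simp only [X₁, Y₁, h', h.1]
    · intro i v hv h
      refine hY₁' i v hv (h.mono ?_ (Set.inter_subset_inter_left _ (hY₁ i)))
      rintro x ⟨⟨hx1, hx2⟩, hx3⟩
      exact ⟨⟨hX₁ i hx1, hx2⟩, fun h => hx3.1 (SimpleGraph.Adj.symm h)⟩
    · intro i v hv h
      refine hX₁' i v hv (h.mono ?_ (Set.inter_subset_inter_left _ (hX₁ i)))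
      rintro x ⟨⟨hx1, hx2⟩, hx3⟩
      exact ⟨⟨hY₁ i hx1, hx2⟩, fun h => hx3.1 (SimpleGraph.Adj.symm h)⟩
  have e₀₁ : IsEncoded G fun i x y => x ∈ X₀ i ∧ y ∈ Y₁ i ∧ r i x y ∧ (G i).Adj x y := by
    refine isEncoded_of_mixed h₁ h₂ hhalf hr (hXA hX₀ hY₁) (hYB hX₀ hY₁) hd₁ ?_ ?_
    · intro i v hv h
      exact hY₁' i v hv (h.mono
        (Set.sdiff_subset_sdiff_left (Set.inter_subset_inter_left _ (hX₀ i)))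
        (Set.inter_subset_inter_left _ (hY₁ i)))
    · intro i v hv h
      exact hv.2 (h.mono
        (Set.inter_subset_inter_left _ (Set.inter_subset_inter_left _ (hY₁ i)))
        (Set.inter_subset_inter_left _ (hX₀ i)))
  have e₁₀ : IsEncoded G fun i y x => y ∈ Y₀ i ∧ x ∈ X₁ i ∧ r i y x ∧ (G i).Adj y x := by
    refine isEncoded_of_mixed h₂.symm h₁.symm hhalf hr (hYB hX₁ hY₀) (hXA hX₁ hY₀) hd₂ ?_ ?_
    · intro i v hv h
      exact hX₁' i v hv (h.mono
        (Set.sdiff_subset_sdiff_left (Set.inter_subset_inter_left _ (hY₀ i)))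
        (Set.inter_subset_inter_left _ (hX₁ i)))
    · intro i v hv h
      exact hv.2 (h.mono
        (Set.inter_subset_inter_left _ (Set.inter_subset_inter_left _ (hX₁ i)))
        (Set.inter_subset_inter_left _ (hY₀ i)))
  refine ((e₀₀.or e₁₁).or (e₀₁.or e₁₀.conv)).congr fun i x y => ⟨?_, ?_⟩
  · rintro ⟨hx, hy, hxy, hadj⟩
    by_cases hx0 : x ∈ X₀ i <;> by_cases hy0 : y ∈ Y₀ i
    · exact Or.inl (Or.inl ⟨hx0, hy0, hxy, hadj⟩)
    · exact Or.inr (Or.inl ⟨hx0, ⟨hy, hy0⟩, hxy, hadj⟩)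
    · exact Or.inr (Or.inr ⟨hy0, ⟨hx, hx0⟩, (r i).symm hxy, hadj.symm⟩)
    · exact Or.inl (Or.inr ⟨⟨hx, hx0⟩, ⟨hy, hy0⟩, hxy, hadj⟩)
  · rintro ((⟨hx, hy, hxy, hadj⟩ | ⟨hx, hy, hxy, hadj⟩) |
      (⟨hx, hy, hxy, hadj⟩ | ⟨hy, hx, hxy, hadj⟩))
    · exact ⟨hX₀ i hx, hY₀ i hy, hxy, hadj⟩
    · exact ⟨hX₁ i hx, hY₁ i hy, hxy, hadj⟩
    · exact ⟨hX₀ i hx, hY₁ i hy, hxy, hadj⟩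
    · exact ⟨hX₁ i hx, hY₀ i hy, (r i).symm hxy, hadj.symm⟩

theorem isEncoded_adj {s t k : ℕ} (hpath : ∀ i, ¬ (bipPath s).IsSemiInducedIn (G i))
    (hcopath : ∀ i, ¬ (bipPath t).bipCompl.IsSemiInducedIn (G i))
    (hhalf : ∀ i, ¬ (halfGraph k).IsSemiInducedIn (G i)) :
    IsEncoded G fun i x y => (G i).Adj x y := by
  obtain ⟨N, hN⟩ := exists_not_hasRank.{u} k
  refine (isReducible hpath hcopath hhalf N N (fun _ => Set.univ) (fun _ => Set.univ)
    (fun _ => ⊤) ((IsDefinable.false G).not.congr fun i x y => ?_)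
    (fun i a => hN _ _ (hhalf i) _ _) (fun i a => hN _ _ (hhalf i) _ _)
    (Or.inl ⟨rfl, rfl⟩)).congr fun i x y => ?_
  · simp
  · refine ⟨fun h => ⟨trivial, trivial, trivial, h⟩, fun h => h.2.2.2⟩

/-! ### Bounded out-degree: degeneracy and colorings -/

section OutDegree

variable {V : Type u} [Finite V] {R : V → V → Prop} {d : ℕ}

/-- In-degrees and out-degrees within `S` have the same sum, so their total averages at most `2 *
d`. -/
theorem exists_ncard_le_of_outDegree (hR : ∀ x, {y | R x y}.ncard ≤ d) (S : Finset V)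
    (hS : S.Nonempty) : ∃ x ∈ S, {y | y ∈ S ∧ (R x y ∨ R y x)}.ncard ≤ 2 * d := by
  classical
  have hout : ∀ x ∈ S, (S.filter fun y => R x y).card ≤ d := fun x _ => by
    rw [← Set.ncard_coe_finset]
    exact (Set.ncard_le_ncard (fun y hy => (Finset.mem_filter.1 hy).2) (Set.toFinite _)).trans
      (hR x)
  have hsum : ∑ x ∈ S, ((S.filter fun y => R x y).card + (S.filter fun y => R y x).card) ≤
      ∑ _x ∈ S, 2 * d := by
    have hswap := Finset.sum_card_bipartiteAbove_eq_sum_card_bipartiteBelow (s := S) (t := S) R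
    have h1 := Finset.sum_le_sum hout
    simp only [Finset.bipartiteAbove, Finset.bipartiteBelow] at hswap
    rw [Finset.sum_add_distrib, ← hswap, ← Finset.mul_sum]
    omega
  obtain ⟨x, hx, h⟩ := Finset.exists_le_of_sum_le hS hsum
  refine ⟨x, hx, le_trans ?_ h⟩
  refine le_trans ?_ (Finset.card_union_le _ _)
  rw [← Set.ncard_coe_finset]
  refine Set.ncard_le_ncard (fun y hy => ?_) (Set.toFinite _)
  simpa [← and_or_left] using hy

/-- Greedy coloring: remove a vertex of total degree at most `2 * d`, color the rest, and give it a
free color. -/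
theorem exists_coloring_of_outDegree (hR : ∀ x, {y | R x y}.ncard ≤ d) :
    ∃ χ : V → ℕ, (∀ x, χ x < 2 * d + 1) ∧ ∀ x y, x ≠ y → R x y → χ x ≠ χ y := by
  classical
  have := Fintype.ofFinite V
  suffices h : ∀ S : Finset V, ∃ χ : V → ℕ, (∀ x, χ x < 2 * d + 1) ∧
      ∀ x ∈ S, ∀ y ∈ S, x ≠ y → R x y → χ x ≠ χ y by
    obtain ⟨χ, h1, h2⟩ := h Finset.univ
    exact ⟨χ, h1, fun x y => h2 x (Finset.mem_univ _) y (Finset.mem_univ _)⟩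
  intro S
  induction hn : S.card generalizing S with
  | zero =>
    rw [Finset.card_eq_zero] at hn
    subst hn
    exact ⟨fun _ => 0, by simp, by simp⟩
  | succ n ih =>
    obtain ⟨x, hx, hdeg⟩ := exists_ncard_le_of_outDegree hR S
      (Finset.card_pos.1 (by omega))
    obtain ⟨χ, h1, h2⟩ := ih (S.erase x) (by rw [Finset.card_erase_of_mem hx]; omega)
    let B : Finset ℕ := (S.filter fun y => R x y ∨ R y x).image χ
    have hB : B.card < (Finset.range (2 * d + 1)).card := by
      rw [Finset.card_range]
      refine lt_of_le_of_lt (Finset.card_image_le.trans (le_trans (le_of_eq ?_) hdeg))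
        (Nat.lt_succ_self _)
      rw [← Set.ncard_coe_finset]
      congr 1
      ext y
      simp
    obtain ⟨c, hc, hcB⟩ := Finset.exists_mem_notMem_of_card_lt_card hB
    have hcB' : ∀ y ∈ S, R x y ∨ R y x → c ≠ χ y := fun y hy h hcy =>
      hcB (Finset.mem_image.2 ⟨y, Finset.mem_filter.2 ⟨hy, h⟩, hcy.symm⟩)
    refine ⟨Function.update χ x c, fun y => ?_, fun y hy z hz hyz hR => ?_⟩
    · by_cases hyx : y = x
      · subst hyx
        simpa using hc
      · rw [Function.update_of_ne hyx]
        exact h1 y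
    · by_cases hyx : y = x
      · subst hyx
        rw [Function.update_self, Function.update_of_ne hyz.symm]
        exact hcB' z hz (Or.inl hR)
      · rw [Function.update_of_ne hyx]
        by_cases hzx : z = x
        · subst hzx
          rw [Function.update_self]
          exact (hcB' y hy (Or.inr hR)).symm
        · rw [Function.update_of_ne hzx]
          exact h2 y (Finset.mem_erase.2 ⟨hyx, hy⟩) z (Finset.mem_erase.2 ⟨hzx, hz⟩) hyz hR

end OutDegree

/-! ### Representatives of the classes of several equivalence relations -/

section Representatives

variable {V : Type u} [Finite V] {N : ℕ}

/-- Representatives of the classes of `N` equivalence relations can be chosen so that classes of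
size at least `N` of different relations have different representatives. -/
theorem exists_representatives (r : Fin N → Setoid V) : ∃ rep : Fin N → V → V,
    (∀ τ v, r τ (rep τ v) v) ∧ (∀ τ v w, r τ v w → rep τ v = rep τ w) ∧
    ∀ τ τ' v w, N ≤ {x | r τ x v}.ncard → N ≤ {x | r τ' x w}.ncard → rep τ v = rep τ' w →
      τ = τ' := by
  classical
  have := Fintype.ofFinite V
  let cls : (Σ τ : Fin N, Quotient (r τ)) → Finset V := fun p =>
    Finset.univ.filter fun x => Quotient.mk (r p.1) x = p.2
  have hcls : ∀ τ v, (cls ⟨τ, Quotient.mk (r τ) v⟩).card = {x | r τ x v}.ncard := by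
    intro τ v
    rw [← Set.ncard_coe_finset]
    congr 1
    ext x
    simp only [cls, Finset.coe_filter, Finset.mem_univ, true_and, Set.mem_ofPred_eq]
    exact Quotient.eq
  let I := {p : Σ τ : Fin N, Quotient (r τ) // N ≤ (cls p).card}
  -- Hall's condition holds by double counting: each class in `I` has at least `N` vertices, and a
  -- vertex lies in at most one class per relation, hence in at most `N`.
  obtain ⟨f, hf, hfmem⟩ := (Finset.all_card_le_biUnion_card_iff_exists_injective
    (fun p : I => cls p.1)).1 (by
      intro s
      rcases s.eq_empty_or_nonempty with rfl | ⟨p, -⟩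
      · simp
      have hN : 0 < N := p.1.1.pos
      refine Nat.le_of_mul_le_mul_right (Finset.card_mul_le_card_mul
        (fun (p : I) (v : V) => v ∈ cls p.1) (m := N) (n := N) ?_ ?_) hN
      · intro p hp
        refine p.2.trans (Finset.card_le_card fun v hv => ?_)
        exact Finset.mem_filter.2 ⟨Finset.mem_biUnion.2 ⟨p, hp, hv⟩, hv⟩
      · intro v _
        refine le_trans (Finset.card_le_card_of_injOn (fun p : I => p.1.1)
          (t := (Finset.univ : Finset (Fin N))) (fun _ _ => Finset.mem_coe.2 (Finset.mem_univ _))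
          ?_) (by simp)
        rintro ⟨⟨τ, q⟩, hp⟩ hp' ⟨⟨τ', q'⟩, hq⟩ hq' heq
        obtain rfl : τ = τ' := heq
        have h1 : Quotient.mk (r τ) v = q :=
          (Finset.mem_filter.1 (Finset.mem_filter.1 (Finset.mem_coe.1 hp')).2).2
        have h2 : Quotient.mk (r τ) v = q' :=
          (Finset.mem_filter.1 (Finset.mem_filter.1 (Finset.mem_coe.1 hq')).2).2
        subst h1 h2
        rfl)
  let g : (Σ τ : Fin N, Quotient (r τ)) → V := fun p =>
    if h : N ≤ (cls p).card then f ⟨p, h⟩ else p.2.out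
  have hg : ∀ p, Quotient.mk (r p.1) (g p) = p.2 := by
    intro p
    by_cases h : N ≤ (cls p).card
    · simp only [g, h, dif_pos]
      exact (Finset.mem_filter.1 (hfmem ⟨p, h⟩)).2
    · simp only [g, h, dif_neg, not_false_eq_true]
      exact Quotient.out_eq _
  refine ⟨fun τ v => g ⟨τ, Quotient.mk (r τ) v⟩, fun τ v => Quotient.exact (hg ⟨τ, _⟩),
    fun τ v w h => ?_, fun τ τ' v w hv hw h => ?_⟩
  · simp only [Quotient.sound h]
  · rw [← hcls] at hv hw
    simp only [g, hv, hw, dif_pos] at h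
    exact congrArg (fun p : I => p.1.1) (hf h)

/-- Representatives as above, with a coloring that allows one to recognize the representatives of
a vertex `v` among all vertices represented by `v` or representing `v`. -/
theorem exists_representatives_coloring (r : Fin N → Setoid V) :
    ∃ (rep : Fin N → V → V) (χ : V → ℕ) (A B : Fin N → Set V),
      (∀ τ v, r τ (rep τ v) v) ∧ (∀ τ v w, r τ v w → rep τ v = rep τ w) ∧
      (∀ v, χ v < 2 * (N * N + N * N * N) + 1) ∧ (∀ τ v, v ∈ A τ ∨ rep τ v ∈ B τ) ∧
      ∀ τ v u, ((∃ τ', u = rep τ' v) ∨ ∃ τ', v = rep τ' u) → χ u = χ (rep τ v) →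
        (v ∈ A τ ∨ u ∈ B τ) → u = rep τ v := by
  classical
  have := Fintype.ofFinite V
  obtain ⟨rep, hrep, hconst, hinj⟩ := exists_representatives r
  let A : Fin N → Set V := fun τ => {v | {x | r τ x v}.ncard < N}
  let B : Fin N → Set V := fun τ => {u | ∃ v ∉ A τ, u = rep τ v}
  -- Pairs that must get different colors. The second kind is restricted to small classes, those
  -- with fewer than `N` vertices, which keeps the out-degree bounded; confusion between two large
  -- classes is excluded by the choice of representatives.
  let R : V → V → Prop := fun u u' => (∃ τ τ', u' = rep τ' (rep τ u)) ∨
    ∃ τ τ' v, u = rep τ v ∧ u' = rep τ' v ∧ v ∈ A τ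
  have hR : ∀ u, {u' | R u u'}.ncard ≤ N * N + N * N * N := by
    intro u
    let S₁ : Finset V := Finset.univ.image fun p : Fin N × Fin N => rep p.2 (rep p.1 u)
    let S₂ : Finset V := Finset.univ.biUnion fun p : Fin N × Fin N =>
      (Finset.univ.filter fun v => u = rep p.1 v ∧ v ∈ A p.1).image (rep p.2)
    have hS₁ : S₁.card ≤ N * N := Finset.card_image_le.trans (by simp)
    have hS₂ : S₂.card ≤ N * N * N := by
      refine (Finset.card_biUnion_le_card_mul _ _ N fun p _ => Finset.card_image_le.trans ?_).trans
        (by simp)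
      rcases (Finset.univ.filter fun v => u = rep p.1 v ∧ v ∈ A p.1).eq_empty_or_nonempty
        with h | ⟨v, hv⟩
      · simp [h]
      · obtain ⟨-, huv, hvA⟩ := Finset.mem_filter.1 hv
        rw [← Set.ncard_coe_finset]
        refine (Set.ncard_le_ncard (fun w hw => ?_) (Set.toFinite _)).trans
          (le_of_lt (show {x | r p.1 x v}.ncard < N from hvA))
        obtain ⟨-, huw, -⟩ := Finset.mem_filter.1 (Finset.mem_coe.1 hw)
        refine (r p.1).trans ((r p.1).symm (hrep p.1 w)) ?_
        rw [← huw, huv]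
        exact hrep p.1 v
    refine le_trans ?_ ((Finset.card_union_le S₁ S₂).trans (add_le_add hS₁ hS₂))
    rw [← Set.ncard_coe_finset]
    refine Set.ncard_le_ncard ?_ (Set.toFinite _)
    rintro u' (⟨τ, τ', rfl⟩ | ⟨τ, τ', v, h1, rfl, h3⟩)
    · exact Finset.mem_coe.2 (Finset.mem_union_left _
        (Finset.mem_image.2 ⟨(τ, τ'), Finset.mem_univ _, rfl⟩))
    · exact Finset.mem_coe.2 (Finset.mem_union_right _ (Finset.mem_biUnion.2
        ⟨(τ, τ'), Finset.mem_univ _, Finset.mem_image.2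
          ⟨v, Finset.mem_filter.2 ⟨Finset.mem_univ _, h1, h3⟩, rfl⟩⟩))
  obtain ⟨χ, hχ, hχR⟩ := exists_coloring_of_outDegree hR
  refine ⟨rep, χ, A, B, hrep, hconst, hχ, fun τ v => ?_, fun τ v u huv hcol hu => ?_⟩
  · by_cases hv : v ∈ A τ
    · exact Or.inl hv
    · exact Or.inr ⟨v, hv, rfl⟩
  · by_contra hne
    rcases huv with ⟨τ', hτ'⟩ | ⟨τ', hτ'⟩
    · by_cases hv : v ∈ A τ
      · exact hχR _ _ (Ne.symm hne) (Or.inr ⟨τ, τ', v, rfl, hτ', hv⟩) hcol.symm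
      · by_cases hv' : v ∈ A τ'
        · exact hχR _ _ hne (Or.inr ⟨τ', τ, v, hτ', rfl, hv'⟩) hcol
        -- Both classes of `v` are large, and the mark `B τ` says that `u` also represents a large
        -- class of the relation `τ`; hence `τ' = τ`.
        · obtain ⟨w, hw, huw⟩ := hu.resolve_left hv
          have := hinj τ' τ v w (not_lt.1 hv') (not_lt.1 hw) (hτ'.symm.trans huw)
          subst this
          exact hne hτ'
    · exact hχR _ _ hne (Or.inl ⟨τ', τ, by rw [← hτ']⟩) hcol

/-- The graph joining each vertex to its representatives. -/
def representativeGraph (rep : Fin N → V → V) : SimpleGraph V where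
  Adj v u := u ≠ v ∧ ((∃ τ, u = rep τ v) ∨ ∃ τ, v = rep τ u)
  symm := ⟨fun _ _ h => ⟨h.1.symm, h.2.symm⟩⟩
  loopless := ⟨fun _ h => h.1 rfl⟩

theorem isDegenerate_representativeGraph (rep : Fin N → V → V) :
    FinGraph.IsDegenerate (2 * N) ⟨V, inferInstance, representativeGraph rep⟩ := by
  classical
  have := Fintype.ofFinite V
  intro H hH
  obtain ⟨x, hx, h⟩ := exists_ncard_le_of_outDegree (R := fun v u => ∃ τ, u = rep τ v) (d := N)
    (fun v => by
      have : {u | ∃ τ, u = rep τ v} = ((Finset.univ.image fun τ => rep τ v : Finset V) : Set V) := by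
        ext u
        simp [eq_comm]
      rw [this, Set.ncard_coe_finset]
      exact Finset.card_image_le.trans (by simp))
    H.verts.toFinite.toFinset (by simpa using hH)
  refine ⟨x, by simpa using hx, le_trans (Set.ncard_le_ncard (fun y hy => ?_) (Set.toFinite _)) h⟩
  have hxy : H.Adj x y := hy
  exact ⟨by simpa using hxy.snd_mem, (H.adj_sub hxy).2⟩

end Representatives

/-! ### Transductions -/

variable {ι : Type v} {V : ι → Type u}

theorem IsDefinable.exists_fin {G : ∀ i, SimpleGraph (V i)} {n : ℕ}
    {R : Fin n → ∀ i, V i → V i → Prop} (h : ∀ τ, IsDefinable G (R τ)) :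
    IsDefinable G (fun i x y => ∃ τ, R τ i x y) := by
  refine (IsDefinable.exists_lt (R := fun m i x y => ∃ hm : m < n, R ⟨m, hm⟩ i x y) n
    fun m hm => (h ⟨m, hm⟩).congr fun i x y => ?_).congr fun i x y => ?_
  · exact ⟨fun ⟨_, h⟩ => h, fun h => ⟨hm, h⟩⟩
  · exact ⟨fun ⟨τ, h⟩ => ⟨τ.1, τ.2, τ.2, h⟩, fun ⟨m, hm, _, h⟩ => ⟨⟨m, hm⟩, h⟩⟩

/-- A family of graphs encoded by equivalences has a family of degenerate counterparts such that
each of the two families is definable in the other. -/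
theorem IsEncoded.exists_degenerate [∀ i, Finite (V i)] {G : ∀ i, SimpleGraph (V i)}
    (hG : IsEncoded G fun i x y => (G i).Adj x y) :
    ∃ (d : ℕ) (D : ∀ i, SimpleGraph (V i)), (∀ i, FinGraph.IsDegenerate d ⟨V i, inferInstance, D i⟩) ∧
      IsDefinable G (fun i x y => (D i).Adj x y) ∧ IsDefinable D fun i x y => (G i).Adj x y := by
  obtain ⟨l, hl, hdec⟩ := hG
  let r : ∀ i, Fin l.length → Setoid (V i) := fun i τ => l.get τ i
  have hr : ∀ τ, IsDefinable G fun i x y => r i τ x y := fun τ => hl _ (l.get_mem τ)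
  choose rep χ A B hrep hconst hχ hAB huniq using fun i => exists_representatives_coloring (r i)
  let D : ∀ i, SimpleGraph (V i) := fun i => representativeGraph (rep i)
  refine ⟨2 * l.length, D, fun i => isDegenerate_representativeGraph (rep i), ?_, ?_⟩
  · have h1 : ∀ τ, IsDefinable G fun i x y => y = rep i τ x := by
      intro τ
      -- With the representatives marked, each class contains exactly one marked vertex.
      refine ((hr τ).and (IsDefinable.memRight G fun i => {y | rep i τ y = y})).congr
        fun i x y => ⟨?_, fun ⟨h1, h2⟩ => ?_⟩
      · rintro rfl
        exact ⟨(r i τ).symm (hrep i τ x), hconst i τ _ _ (hrep i τ x)⟩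
      · rw [hconst i τ x y h1]
        exact h2.symm
    exact ((IsDefinable.eq G).conv.not.and ((IsDefinable.exists_fin h1).or
      (IsDefinable.exists_fin fun τ => (h1 τ).conv)))
  · refine hdec D fun s hs => ?_
    obtain ⟨τ, rfl⟩ := List.mem_iff_get.1 hs
    set K := 2 * (l.length * l.length + l.length * l.length * l.length) + 1
    have h1 : IsDefinable D fun i x y => y = rep i τ x := by
      -- Each vertex carries marks for whether it represents itself and for the color of its
      -- representative; with `A` and `B` these single out the representative among the neighbors in
      -- `D`.
      refine (((IsDefinable.eq D).conv.and
        (IsDefinable.memLeft D fun i => {x | rep i τ x = x})).or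
        (((IsDefinable.adj D).and (IsDefinable.memLeft D fun i => {x | rep i τ x ≠ x})).and
          ((IsDefinable.exists_lt K fun c _ =>
            (IsDefinable.memLeft D fun i => {x | χ i (rep i τ x) = c}).and
            (IsDefinable.memRight D fun i => {y | χ i y = c})).and
          ((IsDefinable.memLeft D fun i => A i τ).or
            (IsDefinable.memRight D fun i => B i τ))))).congr fun i x y => ⟨?_, ?_⟩
      · rintro rfl
        by_cases h : rep i τ x = x
        · exact Or.inl ⟨h, h⟩
        · exact Or.inr ⟨⟨⟨h, Or.inl ⟨τ, rfl⟩⟩, h⟩, ⟨_, hχ i _, rfl, rfl⟩, hAB i τ x⟩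
      · rintro (⟨h1, h2⟩ | ⟨⟨h1, -⟩, ⟨c, -, h3, h4⟩, h5⟩)
        · exact h1.trans h2.symm
        · exact huniq i τ x y h1.2 (h4.trans h3.symm) h5
    refine (h1.comp h1.conv).congr fun i x y => ⟨fun h => ?_, ?_⟩
    · exact ⟨rep i τ x, rfl, hconst i τ x y h⟩
    · rintro ⟨z, rfl, h⟩
      exact (r i τ).trans ((r i τ).symm (hrep i τ x)) (h ▸ hrep i τ y)

theorem IsDefinable.exists_transduction [∀ i, Finite (V i)] {G D : ∀ i, SimpleGraph (V i)}
    (h : IsDefinable G fun i x y => (D i).Adj x y) :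
    ∃ T : Transduction, ∀ i, (⟨V i, inferInstance, D i⟩ : FinGraph.{u}) ∈
      T.image ⟨V i, inferInstance, G i⟩ := by
  obtain ⟨e, he⟩ := h
  refine ⟨⟨⊤, e.toFormula⟩, fun i => ?_⟩
  obtain ⟨c, hc⟩ := he i
  refine ⟨c, (Equiv.subtypeUnivEquiv fun x => ?_).symm, fun x y => ?_⟩
  · let := coloring (G i) c
    exact FirstOrder.Language.Formula.realize_top.2 trivial
  · exact (hc x y).trans (e.realize_toFormula (G i) c x y).symm

end Sparsify

theorem mainTheorem8 (s t k : ℕ) (C : Set Sparsify.FinGraph.{u})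
    (hpath : ∀ G ∈ C, ¬ (Sparsify.bipPath s).IsSemiInducedIn G.graph)
    (hcopath : ∀ G ∈ C, ¬ (Sparsify.bipPath t).bipCompl.IsSemiInducedIn G.graph)
    (hhalf : ∀ G ∈ C, ¬ (Sparsify.halfGraph k).IsSemiInducedIn G.graph) :
    ∃ D : Set Sparsify.FinGraph.{u},
      Sparsify.IsDegenerateClass D ∧ Sparsify.TransductionEquivalent C D := by
  have hfin : ∀ i : C, Finite i.1.V := fun i => i.1.finite
  -- The family is indexed by the class itself, so one expression serves all its members while the
  -- colorings vary with the graph.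
  obtain ⟨d, D, hd, hD, hG⟩ := (Sparsify.isEncoded_adj (V := fun i : C => i.1.V)
    (G := fun i : C => i.1.graph) (fun i => hpath i.1 i.2) (fun i => hcopath i.1 i.2)
    fun i => hhalf i.1 i.2).exists_degenerate
  obtain ⟨T, hT⟩ := hD.exists_transduction
  obtain ⟨T', hT'⟩ := hG.exists_transduction
  refine ⟨Set.range fun i : C => ⟨i.1.V, hfin i, D i⟩, ⟨d, ?_⟩, ⟨T, ?_⟩, ⟨T', ?_⟩⟩
  · rintro _ ⟨i, rfl⟩
    exact hd i
  · rintro _ ⟨i, rfl⟩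
    exact Set.mem_biUnion i.2 (hT i)
  · intro H hH
    exact Set.mem_biUnion ⟨⟨H, hH⟩, rfl⟩ (hT' ⟨H, hH⟩)
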